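/- Work in the two-sorted (numbers and sets of numbers) classical first-order language of second-order arithmetic with symbols $0,1,+,\cdot,<,=,\in$. $\mathsf{RCA}_0$ consists of the basic axioms for $(\mathbb N,0,1,+,\cdot,<)$, induction for $\Sigma^0_1$ formulas and comprehension for $\Delta^0_1$ formulas (with number and set parameters). $\mathsf{WKL}$ is the statement that every infinite tree $T\subseteq 2^{<\mathbb N}$ has an infinite path. $\mathsf{RT}^2_2$ is the statement that for every $f:[\mathbb N]^2\to\{0,1\}$ there is an infinite set $H\subseteq\mathbb N$ on whose pairs $f$ is constant. Rationals are represented by natural-number codes, one code for each rational. Let $[\mathbb Q]^2$ be the set of (unordered) pairs of distinct rationals, each pair being listed in the order of the codes. A coloring $f:[\mathbb Q]^2\to\{0,1\}$ is *stable* if for every $x\in\mathbb Q$ there are a color $c$ and a finite set $S\subseteq\mathbb Q$ with $x\in S$ such that $f(x,y)=c$ for all $y\in\mathbb Q\setminus S$. A set $H\subseteq\mathbb Q$ is *homogeneous with color $c$* if $f(x,y)=c$ for all pairs of distinct elements of $H$; it has *order type $\eta$* (resp. *$\omega$*) if $H$ with the usual order of the rationals is order-isomorphic to $\mathbb Q$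 (resp. $\mathbb N$) with its usual order. $\mathsf{SER}^2_2$ is the statement that for every stable $f:[\mathbb Q]^2\to\{0,1\}$ there is either an infinite homogeneous set with color $0$ or a homogeneous set of order type $\eta$ with color $1$. **Theorem.** $\mathsf{RCA}_0+\mathsf{WKL}\nvdash \mathsf{RT}^2_2\to\mathsf{SER}^2_2$. The same holds for the version of $\mathsf{SER}^2_2$ in which the homogeneous set with color $0$ is required to have order type $\omega$. -/

import Mathlib

namespace SOA

/-! ## The two-sorted language of second-order arithmetic

Variables are de Bruijn indices.  There are two independent families of indices, one for the number
variables and one for the set variables: a number quantifier binds the number variable `0` (and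
shifts the other number variables), a set quantifier binds the set variable `0`. -/

/-- Number terms: variables, `0`, `1`, sums and products. -/
inductive Term : Type
  | var : ℕ → Term
  | zero : Term
  | one : Term
  | add : Term → Term → Term
  | mul : Term → Term → Term

/-- Formulas: the atoms `s = t`, `s < t`, `t ∈ X` (`X` a set variable), falsity, implication, the
number quantifier `∀ n` and the set quantifier `∀ X`.  Equality of sets is not primitive. -/
inductive Formula : Type
  | eq : Term → Term → Formula
  | lt : Term → Term → Formula
  | mem : Term → ℕ → Formula
  | bot : Formula
  | imp : Formula → Formula → Formula
  | allN : Formula → Formula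
  | allS : Formula → Formula

/-- Simultaneous substitution of terms for the variables of a term. -/
def Term.subst (σ : ℕ → Term) : Term → Term
  | .var n => σ n
  | .zero => .zero
  | .one => .one
  | .add s t => .add (s.subst σ) (t.subst σ)
  | .mul s t => .mul (s.subst σ) (t.subst σ)

/-- The term `t` read below `k` additional number quantifiers. -/
def Term.up (k : ℕ) (t : Term) : Term := t.subst fun n => .var (n + k)

/-- The substitution `σ` carried below a number quantifier. -/
def liftN (σ : ℕ → Term) : ℕ → Term
  | 0 => .var 0
  | n + 1 => (σ n).up 1

/-- The renaming `ρ` of set variables carried below a set quantifier. -/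
def liftS (ρ : ℕ → ℕ) : ℕ → ℕ
  | 0 => 0
  | n + 1 => ρ n + 1

/-- Simultaneous capture-avoiding substitution of terms for the free number variables and of set
variables for the free set variables. -/
def Formula.subst : (ℕ → Term) → (ℕ → ℕ) → Formula → Formula
  | σ, _, .eq s t => .eq (s.subst σ) (t.subst σ)
  | σ, _, .lt s t => .lt (s.subst σ) (t.subst σ)
  | σ, ρ, .mem t X => .mem (t.subst σ) (ρ X)
  | _, _, .bot => .bot
  | σ, ρ, .imp φ ψ => .imp (φ.subst σ ρ) (ψ.subst σ ρ)
  | σ, ρ, .allN φ => .allN (φ.subst (liftN σ) ρ)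
  | σ, ρ, .allS φ => .allS (φ.subst σ (liftS ρ))

/-- `φ` read below one additional number quantifier. -/
def Formula.shiftN (φ : Formula) : Formula := φ.subst (fun n => .var (n + 1)) id

/-- `φ` read below one additional set quantifier. -/
def Formula.shiftS (φ : Formula) : Formula := φ.subst .var (· + 1)

/-- `φ(t)`: the body of a number quantifier instantiated with the term `t`. -/
def Formula.instN (φ : Formula) (t : Term) : Formula :=
  φ.subst (fun n => Nat.casesOn n t .var) id

/-- `φ(X)`: the body of a set quantifier instantiated with the set variable `X`. -/
def Formula.instS (φ : Formula) (X : ℕ) : Formula :=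
  φ.subst .var (fun n => Nat.casesOn n X id)

/-! ## The defined connectives and quantifiers -/

/-- Negation. -/
def Formula.neg (φ : Formula) : Formula := φ.imp .bot
/-- Conjunction. -/
def Formula.conj (φ ψ : Formula) : Formula := (φ.imp ψ.neg).neg
/-- Disjunction. -/
def Formula.disj (φ ψ : Formula) : Formula := φ.neg.imp ψ
/-- Equivalence. -/
def Formula.iff (φ ψ : Formula) : Formula := (φ.imp ψ).conj (ψ.imp φ)
/-- The quantifier `∃ n` over numbers. -/
def Formula.exN (φ : Formula) : Formula := φ.neg.allN.neg
/-- The quantifier `∃ X` over sets. -/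
def Formula.exS (φ : Formula) : Formula := φ.neg.allS.neg

end SOA

infixr:60 " ➝ " => SOA.Formula.imp
infixr:70 " ⋎ " => SOA.Formula.disj
infixr:75 " ⋏ " => SOA.Formula.conj
infix:55 " ⭤ " => SOA.Formula.iff
prefix:80 "∼" => SOA.Formula.neg

namespace SOA

open Formula

/-! ## Provability -/

/-- Natural deduction for two-sorted classical first-order logic with equality on the number sort.
`Derivable T Γ φ` says that `φ` is derivable from the finitely many open assumptions `Γ` and the
universal closures of the formulas in `T`. -/
inductive Derivable (T : Set Formula) : List Formula → Formula → Prop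
  | axm {Γ φ} : φ ∈ T → Derivable T Γ φ
  | hyp {Γ φ} : φ ∈ Γ → Derivable T Γ φ
  | impI {Γ φ ψ} : Derivable T (φ :: Γ) ψ → Derivable T Γ (φ ➝ ψ)
  | impE {Γ φ ψ} : Derivable T Γ (φ ➝ ψ) → Derivable T Γ φ → Derivable T Γ ψ
  | raa {Γ φ} : Derivable T (∼φ :: Γ) bot → Derivable T Γ φ
  | allNI {Γ φ} : Derivable T (Γ.map shiftN) φ → Derivable T Γ (allN φ)
  | allNE {Γ φ} (t : Term) : Derivable T Γ (allN φ) → Derivable T Γ (φ.instN t)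
  | allSI {Γ φ} : Derivable T (Γ.map shiftS) φ → Derivable T Γ (allS φ)
  | allSE {Γ φ} (X : ℕ) : Derivable T Γ (allS φ) → Derivable T Γ (φ.instS X)
  | eqI {Γ} (t : Term) : Derivable T Γ (eq t t)
  | eqE {Γ s t} (φ : Formula) : Derivable T Γ (eq s t) → Derivable T Γ (φ.instN s) →
      Derivable T Γ (φ.instN t)

/-- `T ⊢ φ`. -/
def Provable (T : Set Formula) (φ : Formula) : Prop := Derivable T [] φ

/-! ## The system `RCA₀` -/

/-- `Δ⁰₀` formulas: all quantifiers are number quantifiers bounded by a term in which the quantified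
variable does not occur.  (The quantifier `∃ n < t` is `¬ ∀ n < t ¬`.)  Free set variables are
allowed. -/
inductive IsDelta0 : Formula → Prop
  | eq (s t : Term) : IsDelta0 (eq s t)
  | lt (s t : Term) : IsDelta0 (lt s t)
  | mem (t : Term) (X : ℕ) : IsDelta0 (mem t X)
  | bot : IsDelta0 bot
  | imp {φ ψ : Formula} : IsDelta0 φ → IsDelta0 ψ → IsDelta0 (φ ➝ ψ)
  | ball (t : Term) {φ : Formula} : IsDelta0 φ → IsDelta0 (allN (lt (.var 0) (t.up 1) ➝ φ))

/-- `Σ⁰₁` formulas: `∃ n θ` with `θ` a `Δ⁰₀` formula. -/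
def IsSigma1 (φ : Formula) : Prop := ∃ θ, IsDelta0 θ ∧ φ = exN θ

/-- `Π⁰₁` formulas: `∀ n θ` with `θ` a `Δ⁰₀` formula. -/
def IsPi1 (φ : Formula) : Prop := ∃ θ, IsDelta0 θ ∧ φ = allN θ

/-- The basic axioms. -/
inductive BasicAxiom : Formula → Prop
  | succ_ne_zero : BasicAxiom (∼(eq (.add (.var 0) .one) .zero))
  | succ_inj : BasicAxiom
      (eq (.add (.var 0) .one) (.add (.var 1) .one) ➝ eq (.var 0) (.var 1))
  | add_zero : BasicAxiom (eq (.add (.var 0) .zero) (.var 0))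
  | add_succ : BasicAxiom
      (eq (.add (.var 0) (.add (.var 1) .one)) (.add (.add (.var 0) (.var 1)) .one))
  | mul_zero : BasicAxiom (eq (.mul (.var 0) .zero) .zero)
  | mul_succ : BasicAxiom
      (eq (.mul (.var 0) (.add (.var 1) .one)) (.add (.mul (.var 0) (.var 1)) (.var 0)))
  | not_lt_zero : BasicAxiom (∼(lt (.var 0) .zero))
  | lt_succ : BasicAxiom
      (lt (.var 0) (.add (.var 1) .one) ⭤ lt (.var 0) (.var 1) ⋎ eq (.var 0) (.var 1))

/-- Induction for `φ(n)`, where `n` is the number variable `0`: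
`φ(0) ∧ ∀ n (φ(n) → φ(n + 1)) → ∀ n φ(n)`. -/
def inductionAxiom (φ : Formula) : Formula :=
  φ.instN .zero ⋏
      allN (φ ➝ φ.subst (fun n => Nat.casesOn n (.add (.var 0) .one) fun k => .var (k + 1)) id) ➝
    allN φ

/-- Comprehension for `φ(n)` and `ψ(n)`, where `n` is the number variable `0`:
`∀ n (φ(n) ↔ ψ(n)) → ∃ X ∀ n (n ∈ X ↔ φ(n))` with `X` not free in `φ`. -/
def comprehensionAxiom (φ ψ : Formula) : Formula :=
  allN (φ ⭤ ψ) ➝ exS (allN (mem (.var 0) 0 ⭤ φ.shiftS))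

/-- `RCA₀`: the basic axioms, `Σ⁰₁` induction and `Δ⁰₁` comprehension, both with number and set
parameters. -/
def RCA0 : Set Formula :=
  {φ | BasicAxiom φ} ∪ {χ | ∃ φ, IsSigma1 φ ∧ χ = inductionAxiom φ} ∪
    {χ | ∃ φ ψ, IsSigma1 φ ∧ IsPi1 ψ ∧ χ = comprehensionAxiom φ ψ}

/-! ## Codes

In the formulas below `s`, `t`, … are terms and `X`, `F`, … are set variables. -/

/-- The code `(s + t)² + s` of the pair `⟨s, t⟩`. -/
def pair (s t : Term) : Term := .add (.mul (.add s t) (.add s t)) s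

/-- `X` is infinite. -/
def infinite (X : ℕ) : Formula := allN (exN (lt (.var 1) (.var 0) ⋏ mem (.var 0) X))

/-! ## Weak König's lemma

A number of the form `⟨l, ⟨a, b⟩⟩` represents the binary string of length `l` whose entry at `i < l`
is `1` if and only if `1 + a (i + 1)` divides `b` (by the Chinese remainder theorem every binary
string is represented).  The least representative of a string is its code. -/

/-- `t` represents a string of length `l`. -/
def strLen (t l : Term) : Formula :=
  exN (exN (eq (t.up 2) (pair (l.up 2) (pair (.var 1) (.var 0)))))

/-- `t` represents a string with the entry `1` at the place `i`. -/
def strOne (t i : Term) : Formula :=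
  -- `∃ l a b e (t = ⟨l, ⟨a, b⟩⟩ ∧ i < l ∧ b = (1 + a (i + 1)) e)`
  exN (exN (exN (exN (eq (t.up 4) (pair (.var 3) (pair (.var 2) (.var 1))) ⋏
    lt (i.up 4) (.var 3) ⋏
    eq (.var 1) (.mul (.add .one (.mul (.var 2) (.add (i.up 4) .one))) (.var 0))))))

/-- The string represented by `s` is an initial segment of the string represented by `t`. -/
def strPrefix (s t : Term) : Formula :=
  -- `∃ k l (|s| = k ∧ |t| = l ∧ k < l + 1 ∧ ∀ i < k (s(i) = 1 ↔ t(i) = 1))`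
  exN (exN (strLen (s.up 2) (.var 1) ⋏ strLen (t.up 2) (.var 0) ⋏
    lt (.var 1) (.add (.var 0) .one) ⋏
    allN (lt (.var 0) (.var 2) ➝ (strOne (s.up 3) (.var 0) ⭤ strOne (t.up 3) (.var 0)))))

/-- `t` is the code of a binary string: it represents a string, and no smaller number represents
the same string. -/
def isStr (t : Term) : Formula :=
  exN (strLen (t.up 1) (.var 0)) ⋏
    allN (lt (.var 0) (t.up 1) ➝
      ∼(strPrefix (.var 0) (t.up 1) ⋏ strPrefix (t.up 1) (.var 0)))

/-- `X` is a binary tree: a set of (codes of) binary strings that is closed under initial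
segments. -/
def isTree (X : ℕ) : Formula :=
  allN (mem (.var 0) X ➝ isStr (.var 0)) ⋏
    allN (allN (isStr (.var 1) ⋏ mem (.var 0) X ⋏ strPrefix (.var 1) (.var 0) ➝ mem (.var 1) X))

/-- `P` (viewed as the infinite binary sequence that is its characteristic function) is a path
through the tree `X`: all its finite initial segments are in `X`. -/
def isPath (P X : ℕ) : Formula :=
  -- `∀ l ∃ t ∈ X (|t| = l ∧ ∀ i < l (t(i) = 1 ↔ i ∈ P))`
  allN (exN (mem (.var 0) X ⋏ strLen (.var 0) (.var 1) ⋏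
    allN (lt (.var 0) (.var 2) ➝ (strOne (.var 1) (.var 0) ⭤ mem (.var 0) P))))

/-- Weak König's lemma: every infinite binary tree has a path. -/
def WKL : Formula := allS (isTree 0 ⋏ infinite 0 ➝ exS (isPath 0 1))

/-! ## Ramsey's theorem for pairs

A set `F` is viewed as the 2-coloring of the pairs `s < t` of numbers in which `⟨s, t⟩ ∈ F` means
color `1` and `⟨s, t⟩ ∉ F` means color `0`. -/

/-- The pair `s < t` has the color `c`. -/
def hasColor (F : ℕ) (c : Fin 2) (s t : Term) : Formula :=
  if c = 1 then mem (pair s t) F else ∼(mem (pair s t) F)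

/-- All pairs of elements of `H` have the color `c`. -/
def homogeneous (F H : ℕ) (c : Fin 2) : Formula :=
  allN (allN (mem (.var 1) H ⋏ mem (.var 0) H ⋏ lt (.var 1) (.var 0) ➝
    hasColor F c (.var 1) (.var 0)))

/-- Ramsey's theorem for pairs and two colors: every 2-coloring of the pairs of numbers has an
infinite homogeneous set. -/
def RT22 : Formula := allS (exS (infinite 0 ⋏ (homogeneous 1 0 0 ⋎ homogeneous 1 0 1)))

/-! ## The rationals and the stable Erdős–Rado theorem

The rational number `(a - b) / c`, written with natural numbers `a`, `b`, `c` such that `a = 0` or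
`b = 0`, `c > 0` and `gcd (a + b, c) = 1`, has the code `⟨⟨a, b⟩, c⟩`. Thus every rational number
has exactly one code. -/

/-- `t` is the code of a rational number. -/
def isRat (t : Term) : Formula :=
  -- `∃ a b c (t = ⟨⟨a, b⟩, c⟩ ∧ (a = 0 ∨ b = 0) ∧ 0 < c ∧ ∀ d u v (d u = a + b ∧ d v = c → d = 1))`
  exN (exN (exN (eq (t.up 3) (pair (pair (.var 2) (.var 1)) (.var 0)) ⋏
    (eq (.var 2) .zero ⋎ eq (.var 1) .zero) ⋏
    lt .zero (.var 0) ⋏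
    allN (allN (allN (eq (.mul (.var 2) (.var 1)) (.add (.var 5) (.var 4)) ⋏
      eq (.mul (.var 2) (.var 0)) (.var 3) ➝ eq (.var 2) .one))))))

/-- The standard strict order of the rationals, for codes `s`, `t` of rationals. -/
def ltRat (s t : Term) : Formula :=
  -- `∃ a b c a' b' c' (s = ⟨⟨a, b⟩, c⟩ ∧ t = ⟨⟨a', b'⟩, c'⟩ ∧ a c' + b' c < a' c + b c')`
  exN (exN (exN (exN (exN (exN (
    eq (s.up 6) (pair (pair (.var 5) (.var 4)) (.var 3)) ⋏
    eq (t.up 6) (pair (pair (.var 2) (.var 1)) (.var 0)) ⋏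
    lt (.add (.mul (.var 5) (.var 0)) (.mul (.var 1) (.var 3)))
      (.add (.mul (.var 2) (.var 3)) (.mul (.var 4) (.var 0)))))))))

/-- `X` is a set of rationals. -/
def ratSubset (X : ℕ) : Formula := allN (mem (.var 0) X ➝ isRat (.var 0))

/-- There is an isomorphism from the strict linear order `(A, lt)` onto the strict linear order
`(X, ltRat)`, where `X` is a set of rationals.  Below `∃ G` the set variable `X` becomes `X + 1`. -/
def orderIso (A : Term → Formula) (lt : Term → Term → Formula) (X : ℕ) : Formula :=
  exS (
    -- `∀ x ∈ A ∃ y ∈ X (⟨x, y⟩ ∈ G)`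
    allN (A (.var 0) ➝ exN (mem (.var 0) (X + 1) ⋏ mem (pair (.var 1) (.var 0)) 0)) ⋏
    -- `∀ y ∈ X ∃ x ∈ A (⟨x, y⟩ ∈ G)`
    allN (mem (.var 0) (X + 1) ➝ exN (A (.var 0) ⋏ mem (pair (.var 0) (.var 1)) 0)) ⋏
    -- `∀ x x' ∈ A ∀ y y' ∈ X (⟨x, y⟩ ∈ G ∧ ⟨x', y'⟩ ∈ G → (x < x' ↔ y < y'))`
    allN (allN (allN (allN (A (.var 3) ⋏ A (.var 2) ⋏
      mem (.var 1) (X + 1) ⋏ mem (.var 0) (X + 1) ⋏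
      mem (pair (.var 3) (.var 1)) 0 ⋏ mem (pair (.var 2) (.var 0)) 0 ➝
      (lt (.var 3) (.var 2) ⭤ ltRat (.var 1) (.var 0)))))))

/-- The set `X` of rationals has the order type `η` of the rationals. -/
def orderTypeEta (X : ℕ) : Formula := orderIso isRat ltRat X

/-- The set `X` of rationals has the order type `ω`. -/
def orderTypeOmega (X : ℕ) : Formula := orderIso (fun t => eq t t) lt X

/-- The 2-coloring `F` of the pairs of rationals is stable: for every rational `x` there is a color
`c` such that the pair of `x` and `y` has the color `c` for all but finitely many rationals `y`.  A
pair of rationals is listed in the order of the codes, and a finite set of exceptions (which may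
contain the finitely many rationals whose code is not larger than that of `x`) is given by a
bound. -/
def stable (F : ℕ) : Formula :=
  allN (isRat (.var 0) ➝ exN (
    allN (isRat (.var 0) ⋏ lt (.var 1) (.var 0) ⋏ lt (.var 2) (.var 0) ➝
      hasColor F 0 (.var 2) (.var 0)) ⋎
    allN (isRat (.var 0) ⋏ lt (.var 1) (.var 0) ⋏ lt (.var 2) (.var 0) ➝
      hasColor F 1 (.var 2) (.var 0))))

/-- The stable Erdős–Rado theorem for pairs: every stable 2-coloring of the pairs of rationals has
an infinite homogeneous set with color `0` or a homogeneous set of order type `η` with color `1`. -/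
def SER22 : Formula :=
  allS (stable 0 ➝ exS (ratSubset 0 ⋏
    (infinite 0 ⋏ homogeneous 1 0 0 ⋎ orderTypeEta 0 ⋏ homogeneous 1 0 1)))

/-- The variant of `SER22` in which the homogeneous set with color `0` is required to have order
type `ω` in the order of the rationals. -/
def SER22Omega : Formula :=
  allS (stable 0 ➝ exS (ratSubset 0 ⋏
    (orderTypeOmega 0 ⋏ homogeneous 1 0 0 ⋎ orderTypeEta 0 ⋏ homogeneous 1 0 1)))

end SOA

namespace SOA

open Formula

/-! ## Semantics in ω-models -/

/-! The independence is witnessed by an ω-model whose sets are the columns of a sequence `D`; column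
`0` is a stable coloring `f` with limit colors `A`. An infinite homogeneous set of color `b` lies
inside `A = b` (`limit_of_homog`). So it suffices that every set of the model inside `A = 0` is
finite, and that no set of the model inside `A = 1` is infinite on each of arbitrarily many disjoint
rational intervals, as a set of type `η` would be. Computability is replaced by a countable family
`𝒮` of open sets (`OpenFamily`), closed under the operations that the construction performs.

The invariant compares `A` with the sets `L i`, the complements of finite unions of intervals. By
`Fair`, a closed property of `A, C` whose complement is in `𝒮` also holds of finite modifications of
so many `L i` that every set of at most `N` numbers lies in one of them. By `Good`, such indices `i`
can be found that contain an interval from each of finitely many prescribed rows of sufficiently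
many disjoint intervals. For `N = 1` this gives both conclusions: a set inside `A = 0` is almost
disjoint from finitely many `L i` that cover everything, and a set inside `A = 1` is almost
contained in some `L i`, hence finite on an interval of the given row.

Goodness holds initially for a generic coloring (`good_of_generic`), since a forcing condition fixes
only finitely many limit colors. Closed classes have members that preserve it
(`OpenFamily.exists_keeps`), which yields weak König's lemma and, through separating classes,
comprehension. For Ramsey's theorem, Mathias forcing with reservoirs in a nonprincipal ultrafilter
builds homogeneous sets of both colors together. A family covering all sets of size `N₀ + N₁`,
divided between the colors, covers for `N₀` on one side or for `N₁` on the other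
(`RamseyCond.Valid.decides`). As goodness treats finitely many rows at once, failures for both
colors could be merged, so one of the two sets preserves it (`Good.exists_homog`). The iteration is
`exists_columns`. -/

/-- A set of natural numbers, given by its characteristic function. -/
abbrev Bits := ℕ → Bool

/-- A sequence of sets. -/
abbrev Orc := ℕ → Bits

/-- Prepend an element to a sequence. -/
def scons {α : Type*} (a : α) (f : ℕ → α) : ℕ → α
  | 0 => a
  | n + 1 => f n

@[simp] theorem scons_zero {α : Type*} (a : α) (f : ℕ → α) : scons a f 0 = a := rfl
@[simp] theorem scons_succ {α : Type*} (a : α) (f : ℕ → α) (n : ℕ) : scons a f (n + 1) = f n := rfl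

/-- The value of a term. -/
def Term.eval (e : ℕ → ℕ) : Term → ℕ
  | .var n => e n
  | .zero => 0
  | .one => 1
  | .add s t => s.eval e + t.eval e
  | .mul s t => s.eval e * t.eval e

/-- Truth in the ω-model with the second-order part `M`. -/
def Sat (M : Set Bits) : Formula → (ℕ → ℕ) → Orc → Prop
  | .eq s t, e, _ => s.eval e = t.eval e
  | .lt s t, e, _ => s.eval e < t.eval e
  | .mem t X, e, S => S X (t.eval e) = true
  | .bot, _, _ => False
  | .imp φ ψ, e, S => Sat M φ e S → Sat M ψ e S
  | .allN φ, e, S => ∀ n, Sat M φ (scons n e) S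
  | .allS φ, e, S => ∀ X ∈ M, Sat M φ e (scons X S)

section Connectives
variable (M : Set Bits) (φ ψ : Formula) (s t : Term) (X : ℕ) (e : ℕ → ℕ) (S : Orc)

@[simp] theorem sat_eq : Sat M (.eq s t) e S ↔ s.eval e = t.eval e := Iff.rfl
@[simp] theorem sat_lt : Sat M (.lt s t) e S ↔ s.eval e < t.eval e := Iff.rfl
@[simp] theorem sat_mem : Sat M (.mem t X) e S ↔ S X (t.eval e) = true := Iff.rfl
@[simp] theorem sat_bot : Sat M .bot e S ↔ False := Iff.rfl
@[simp] theorem sat_imp : Sat M (φ ➝ ψ) e S ↔ (Sat M φ e S → Sat M ψ e S) := Iff.rfl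
@[simp] theorem sat_allN : Sat M (.allN φ) e S ↔ ∀ n, Sat M φ (scons n e) S := Iff.rfl
@[simp] theorem sat_allS : Sat M (.allS φ) e S ↔ ∀ X ∈ M, Sat M φ e (scons X S) := Iff.rfl
@[simp] theorem sat_neg : Sat M (∼φ) e S ↔ ¬ Sat M φ e S := Iff.rfl
@[simp] theorem sat_conj : Sat M (φ ⋏ ψ) e S ↔ Sat M φ e S ∧ Sat M ψ e S := by
  simp [Formula.conj]
@[simp] theorem sat_disj : Sat M (φ ⋎ ψ) e S ↔ Sat M φ e S ∨ Sat M ψ e S := by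
  simp [Formula.disj, or_iff_not_imp_left]
@[simp] theorem sat_iff : Sat M (φ ⭤ ψ) e S ↔ (Sat M φ e S ↔ Sat M ψ e S) := by
  simp [Formula.iff, iff_def]
@[simp] theorem sat_exN : Sat M (.exN φ) e S ↔ ∃ n, Sat M φ (scons n e) S := by
  simp [Formula.exN]
@[simp] theorem sat_exS : Sat M (.exS φ) e S ↔ ∃ X ∈ M, Sat M φ e (scons X S) := by
  simp [Formula.exS]

end Connectives

section Eval
variable (e : ℕ → ℕ)
@[simp] theorem eval_var (n : ℕ) : (Term.var n).eval e = e n := rfl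
@[simp] theorem eval_zero : Term.zero.eval e = 0 := rfl
@[simp] theorem eval_one : Term.one.eval e = 1 := rfl
@[simp] theorem eval_add (s t : Term) : (Term.add s t).eval e = s.eval e + t.eval e := rfl
@[simp] theorem eval_mul (s t : Term) : (Term.mul s t).eval e = s.eval e * t.eval e := rfl
end Eval

theorem Term.eval_subst (σ : ℕ → Term) (e : ℕ → ℕ) (t : Term) :
    (t.subst σ).eval e = t.eval fun n => (σ n).eval e := by
  induction t <;> simp_all [Term.subst]

theorem Term.eval_up (k : ℕ) (e : ℕ → ℕ) (t : Term) :
    (t.up k).eval e = t.eval fun n => e (n + k) := by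
  simp [Term.up, Term.eval_subst]

theorem eval_liftN (σ : ℕ → Term) (m : ℕ) (e : ℕ → ℕ) :
    (fun n => (liftN σ n).eval (scons m e)) = scons m fun n => (σ n).eval e := by
  funext n
  cases n <;> simp [liftN, Term.eval_up]

theorem scons_liftS (ρ : ℕ → ℕ) (Y : Bits) (S : Orc) :
    (fun n => scons Y S (liftS ρ n)) = scons Y fun n => S (ρ n) := by
  funext n
  cases n <;> simp [liftS]

theorem sat_subst (M : Set Bits) (φ : Formula) (σ : ℕ → Term) (ρ : ℕ → ℕ) (e : ℕ → ℕ) (S : Orc) :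
    Sat M (φ.subst σ ρ) e S ↔ Sat M φ (fun n => (σ n).eval e) (fun n => S (ρ n)) := by
  induction φ generalizing σ ρ e S with
  | eq | lt | mem => simp [Formula.subst, Term.eval_subst]
  | bot => simp [Formula.subst]
  | imp φ ψ ih1 ih2 => simp [Formula.subst, ih1, ih2]
  | allN φ ih => simp [Formula.subst, ih, eval_liftN]
  | allS φ ih => simp [Formula.subst, ih, scons_liftS]

theorem sat_shiftN (M : Set Bits) (φ : Formula) (m : ℕ) (e : ℕ → ℕ) (S : Orc) :
    Sat M φ.shiftN (scons m e) S ↔ Sat M φ e S := by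
  simp [shiftN, sat_subst]

theorem sat_shiftS (M : Set Bits) (φ : Formula) (Y : Bits) (e : ℕ → ℕ) (S : Orc) :
    Sat M φ.shiftS e (scons Y S) ↔ Sat M φ e S := by
  simp [shiftS, sat_subst]

theorem sat_instN (M : Set Bits) (φ : Formula) (t : Term) (e : ℕ → ℕ) (S : Orc) :
    Sat M (φ.instN t) e S ↔ Sat M φ (scons (t.eval e) e) S := by
  rw [instN, sat_subst]
  have : (fun n => Term.eval e (Nat.casesOn n t Term.var)) = scons (t.eval e) e := by
    funext n; cases n <;> rfl
  rw [this]; rfl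

theorem sat_instS (M : Set Bits) (φ : Formula) (X : ℕ) (e : ℕ → ℕ) (S : Orc) :
    Sat M (φ.instS X) e S ↔ Sat M φ e (scons (S X) S) := by
  rw [instS, sat_subst]
  have : (fun n => S (Nat.casesOn n X id)) = scons (S X) S := by
    funext n; cases n <;> rfl
  rw [this]; rfl

/-! ### Soundness for ω-models. -/

theorem Derivable.sound {T : Set Formula} {M : Set Bits}
    (hT : ∀ ψ ∈ T, ∀ e S, (∀ j, S j ∈ M) → Sat M ψ e S) {Γ : List Formula} {φ : Formula}
    (h : Derivable T Γ φ) :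
    ∀ e S, (∀ j, S j ∈ M) → (∀ ψ ∈ Γ, Sat M ψ e S) → Sat M φ e S := by
  induction h with
  | axm h => exact fun e S hS _ => hT _ h e S hS
  | hyp h => exact fun e S _ hΓ => hΓ _ h
  | impI _ ih =>
    intro e S hS hΓ h
    exact ih e S hS (by simpa [h] using hΓ)
  | impE _ _ ih1 ih2 => exact fun e S hS hΓ => ih1 e S hS hΓ (ih2 e S hS hΓ)
  | raa _ ih =>
    intro e S hS hΓ
    by_contra h
    exact ih e S hS (by simpa [h] using hΓ)
  | allNI _ ih =>
    intro e S hS hΓ n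
    exact ih _ S hS (by simpa [sat_shiftN] using hΓ)
  | allNE t _ ih =>
    intro e S hS hΓ
    exact (sat_instN ..).2 (ih e S hS hΓ _)
  | allSI _ ih =>
    intro e S hS hΓ X hX
    refine ih e _ ?_ (by simpa [sat_shiftS] using hΓ)
    rintro (_ | j)
    exacts [hX, hS j]
  | allSE X _ ih =>
    intro e S hS hΓ
    exact (sat_instS ..).2 (ih e S hS hΓ _ (hS X))
  | eqI t => exact fun _ _ _ _ => rfl
  | eqE φ _ _ ih1 ih2 =>
    intro e S hS hΓ
    have h1 := ih1 e S hS hΓ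
    have h2 := (sat_instN ..).1 (ih2 e S hS hΓ)
    rw [sat_eq] at h1
    rw [sat_instN]
    rwa [h1] at h2

/-! ### Finite dependence and topological complexity of truth. -/

theorem Term.exists_bound (t : Term) :
    ∃ k, ∀ e e' : ℕ → ℕ, (∀ i < k, e i = e' i) → t.eval e = t.eval e' := by
  induction t with
  | var n => exact ⟨n + 1, fun e e' h => h n (by omega)⟩
  | zero | one => exact ⟨0, fun _ _ _ => rfl⟩
  | add s t ihs iht | mul s t ihs iht =>
    obtain ⟨k, hk⟩ := ihs
    obtain ⟨l, hl⟩ := iht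
    refine ⟨max k l, fun e e' h => ?_⟩
    simp [hk e e' fun i hi => h i (by omega), hl e e' fun i hi => h i (by omega)]

theorem scons_congr {α : Type*} {a : α} {f g : ℕ → α} {k : ℕ} (h : ∀ i < k, f i = g i) :
    ∀ i < k, scons a f i = scons a g i := by
  rintro (_ | i) hi
  exacts [rfl, h i (by omega)]

/-- Only finitely many variables matter for the truth of a formula. -/
theorem exists_bound (M : Set Bits) (φ : Formula) :
    ∃ k, ∀ e e' : ℕ → ℕ, ∀ S S' : Orc, (∀ i < k, e i = e' i) → (∀ i < k, S i = S' i) →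
      (Sat M φ e S ↔ Sat M φ e' S') := by
  induction φ with
  | eq s t | lt s t =>
    obtain ⟨k, hk⟩ := s.exists_bound
    obtain ⟨l, hl⟩ := t.exists_bound
    refine ⟨max k l, fun e e' S S' h _ => ?_⟩
    simp [hk e e' fun i hi => h i (by omega), hl e e' fun i hi => h i (by omega)]
  | mem t X =>
    obtain ⟨k, hk⟩ := t.exists_bound
    refine ⟨max k (X + 1), fun e e' S S' h h' => ?_⟩
    simp [hk e e' fun i hi => h i (by omega), h' X (by omega)]
  | bot => exact ⟨0, fun _ _ _ _ _ _ => Iff.rfl⟩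
  | imp φ ψ ih1 ih2 =>
    obtain ⟨k, hk⟩ := ih1
    obtain ⟨l, hl⟩ := ih2
    refine ⟨max k l, fun e e' S S' h h' => ?_⟩
    rw [sat_imp, sat_imp,
      hk e e' S S' (fun i hi => h i (by omega)) (fun i hi => h' i (by omega)),
      hl e e' S S' (fun i hi => h i (by omega)) (fun i hi => h' i (by omega))]
  | allN φ ih =>
    obtain ⟨k, hk⟩ := ih
    exact ⟨k, fun e e' S S' h h' => forall_congr' fun n => hk _ _ _ _ (scons_congr h) h'⟩
  | allS φ ih =>
    obtain ⟨k, hk⟩ := ih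
    exact ⟨k, fun e e' S S' h h' => forall₂_congr fun X _ => hk _ _ _ _ h (scons_congr h')⟩

/-- There are no set quantifiers, so the range of the sets is irrelevant; later it is taken to be
`∅`. -/
theorem IsDelta0.sat_iff_sat {φ : Formula} (h : IsDelta0 φ) (M M' : Set Bits) (e : ℕ → ℕ)
    (S : Orc) : Sat M φ e S ↔ Sat M' φ e S := by
  induction h generalizing e with
  | eq | lt | mem | bot => rfl
  | imp _ _ ih1 ih2 => rw [sat_imp, sat_imp, ih1, ih2]
  | ball t _ ih => exact forall_congr' fun n => imp_congr Iff.rfl (ih _)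

/-- An atom reads at most one bit, and a bounded quantifier is a finite intersection. -/
theorem IsDelta0.isClopen {φ : Formula} (h : IsDelta0 φ) (M : Set Bits) (e : ℕ → ℕ) :
    IsClopen {S : Orc | Sat M φ e S} := by
  induction h generalizing e with
  | eq s t | lt s t => exact ⟨isClosed_const, isOpen_const⟩
  | mem t X =>
    exact (isClopen_discrete {true}).preimage
      ((continuous_apply (t.eval e)).comp (continuous_apply X))
  | bot => simp [isClopen_empty]
  | imp _ _ ih1 ih2 =>
    have := (ih1 e).compl.union (ih2 e)
    convert this using 1
    ext S
    simp [imp_iff_not_or]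
  | @ball t φ _ ih =>
    have : {S : Orc | Sat M (.allN (.lt (.var 0) (t.up 1) ➝ φ)) e S} =
        ⋂ n ∈ Finset.range (t.eval e), {S : Orc | Sat M φ (scons n e) S} := by
      ext S
      simp [Term.eval_up]
    rw [this]
    exact isClopen_biInter_finset fun n _ => ih _

/-! ### Countability of the syntax. -/

instance : Countable Term := by
  -- A tag for the constructor and the length of the first subcode make the concatenation uniquely
  -- decodable.
  let f : Term → List ℕ := fun t => Term.rec (fun n => [0, n]) [1] [2]
    (fun _ _ a b => 3 :: a.length :: (a ++ b)) (fun _ _ a b => 4 :: a.length :: (a ++ b)) t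
  refine Function.Injective.countable (f := f) ?_
  intro s
  induction s with
  | var n => intro t h; cases t <;> simp_all [f]
  | zero | one => intro t h; cases t <;> simp_all [f]
  | add a b iha ihb | mul a b iha ihb =>
    intro t h
    cases t <;> simp only [f, List.cons.injEq, reduceCtorEq, false_and, and_false] at h <;>
      try omega
    obtain ⟨_, h1, h2⟩ := h
    obtain ⟨h3, h4⟩ := List.append_inj h2 h1
    rw [iha h3, ihb h4]

instance : Countable Formula := by
  obtain ⟨g, hg⟩ := exists_injective_nat Term
  let f : Formula → List ℕ := fun t => Formula.rec (fun s t => [0, g s, g t])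
    (fun s t => [1, g s, g t]) (fun s n => [2, g s, n]) [3]
    (fun _ _ a b => 4 :: a.length :: (a ++ b)) (fun _ a => 5 :: a) (fun _ a => 6 :: a) t
  refine Function.Injective.countable (f := f) ?_
  intro s
  induction s with
  | eq a b | lt a b => intro t h; cases t <;> simp_all [f, hg.eq_iff]
  | mem a n => intro t h; cases t <;> simp_all [f, hg.eq_iff]
  | bot => intro t h; cases t <;> simp_all [f]
  | imp a b iha ihb =>
    intro t h
    cases t <;> simp only [f, List.cons.injEq, reduceCtorEq, false_and, and_false] at h <;>
      try omega
    obtain ⟨_, h1, h2⟩ := h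
    obtain ⟨h3, h4⟩ := List.append_inj h2 h1
    rw [iha h3, ihb h4]
  | allN a ih | allS a ih =>
    intro t h
    cases t <;> simp only [f, List.cons.injEq, reduceCtorEq, false_and] at h <;>
      try omega
    rw [ih h.2]

end SOA

namespace SOA

open Set Filter Topology

/-! ## Countable families of open sets of sequences of sets -/

/-- Remove the first entry of a sequence. -/
def tail {α : Type*} (f : ℕ → α) : ℕ → α := fun n => f (n + 1)

@[simp] theorem tail_apply {α : Type*} (f : ℕ → α) (n : ℕ) : tail f n = f (n + 1) := rfl
@[simp] theorem tail_scons {α : Type*} (a : α) (f : ℕ → α) : tail (scons a f) = f := rfl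

/-- The code of a pair of numbers. -/
def npair (x y : ℕ) : ℕ := (x + y) * (x + y) + x

/-- All pairs of elements of `H` have the color `b` in the coloring `g`. -/
def Homog (g : Bits) (b : Bool) (H : Set ℕ) : Prop :=
  ∀ x ∈ H, ∀ y ∈ H, x < y → g (npair x y) = b

theorem Homog.mono {g : Bits} {b : Bool} {H H' : Set ℕ} (h : Homog g b H) (hs : H' ⊆ H) :
    Homog g b H' := fun x hx y hy => h x (hs hx) y (hs hy)

/-- The characteristic function of a finite set. -/
def finBits (F : Finset ℕ) : Bits := fun n => decide (n ∈ F)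

@[fun_prop]
theorem continuous_scons {X α : Type*} [TopologicalSpace X] [TopologicalSpace α] {f : X → α}
    {g : X → ℕ → α} (hf : Continuous f) (hg : Continuous g) :
    Continuous fun x => scons (f x) (g x) :=
  continuous_pi fun n => by
    cases n with
    | zero => simpa using hf
    | succ n => exact (continuous_apply n).comp hg

@[fun_prop]
theorem continuous_tail {α : Type*} [TopologicalSpace α] :
    Continuous (tail : (ℕ → α) → ℕ → α) :=
  continuous_pi fun n => continuous_apply (n + 1)

/-- The sequences `Z` such that for every `Y` either `Y, Z₁, Z₂, …` is in `U` or
`Z₀, Y, Z₁, Z₂, …` is in `R`. -/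
def forallBits (U R : Set Orc) : Set Orc :=
  {Z | ∀ Y, scons Y (tail Z) ∈ U ∨ scons (Z 0) (scons Y (tail Z)) ∈ R}

/-- The sequences `Z` such that a finite subset of `Z₁` can be added to `F` in such a way that the
result is homogeneous with color `b` and belongs with the rest of `Z` to `R`. -/
def star (F : Finset ℕ) (b : Bool) (j : ℕ) (R : Set Orc) : Set Orc :=
  {Z | ∃ E : Finset ℕ, (∀ n ∈ E, Z 1 n = true) ∧ Homog (Z (j + 2)) b ↑(F ∪ E) ∧
    scons (Z 0) (scons (finBits (F ∪ E)) (tail (tail Z))) ∈ R}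

/-- The complement is the projection of a closed set along the compact Cantor space, hence closed.
This is what allows quantification over all sets without leaving the open sets. -/
theorem isOpen_forallBits {U R : Set Orc} (hU : IsOpen U) (hR : IsOpen R) :
    IsOpen (forallBits U R) := by
  have h1 : Continuous fun p : Bits × Orc => scons p.1 (tail p.2) := by fun_prop
  have h2 : Continuous fun p : Bits × Orc => scons (p.2 0) (scons p.1 (tail p.2)) := by fun_prop
  have hc := ((hU.preimage h1).union (hR.preimage h2)).isClosed_compl
  have := (isClosedMap_snd_of_compactSpace (X := Bits) (Y := Orc) _ hc).isOpen_compl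
  convert this using 1
  ext Z
  simp [forallBits, imp_iff_or_not, or_comm]

theorem isClopen_bit (i n : ℕ) (b : Bool) : IsClopen {Z : Orc | Z i n = b} :=
  (isClopen_discrete {b}).preimage ((continuous_apply n).comp (continuous_apply i))

theorem isClopen_finset_forall {α X : Type*} [TopologicalSpace X] (E : Finset α) {p : α → X → Prop}
    (h : ∀ a ∈ E, IsClopen {x | p a x}) : IsClopen {x | ∀ a ∈ E, p a x} := by
  have : {x | ∀ a ∈ E, p a x} = ⋂ a ∈ E, {x | p a x} := by ext; simp
  rw [this]
  exact isClopen_biInter_finset h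

theorem isClopen_homog (j : ℕ) (b : Bool) (F : Finset ℕ) :
    IsClopen {Z : Orc | Homog (Z j) b ↑F} :=
  isClopen_finset_forall F fun x _ => isClopen_finset_forall F fun y _ => by
    by_cases hxy : x < y
    · simpa [hxy] using isClopen_bit j _ b
    · simp [hxy, isClopen_univ]

theorem isOpen_star (F : Finset ℕ) (b : Bool) (j : ℕ) {R : Set Orc} (hR : IsOpen R) :
    IsOpen (star F b j R) := by
  have : star F b j R = ⋃ E : Finset ℕ, {Z : Orc | ∀ n ∈ E, Z 1 n = true} ∩
      ({Z : Orc | Homog (Z (j + 2)) b ↑(F ∪ E)} ∩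
        {Z : Orc | scons (Z 0) (scons (finBits (F ∪ E)) (tail (tail Z))) ∈ R}) := by
    ext Z; simp [star]
  rw [this]
  refine isOpen_iUnion fun E => IsOpen.inter ?_ (IsOpen.inter ?_ ?_)
  · exact (isClopen_finset_forall E fun n _ => isClopen_bit 1 n true).isOpen
  · exact (isClopen_homog _ b _).isOpen
  · exact hR.preimage (by fun_prop)

/-- A countable family of open sets closed under some operations. -/
structure OpenFamily (maps : Set (Orc → Orc)) (𝒮 : Set (Set Orc)) : Prop where
  countable : 𝒮.Countable
  isOpen : ∀ R ∈ 𝒮, IsOpen R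
  union : ∀ U ∈ 𝒮, ∀ R ∈ 𝒮, U ∪ R ∈ 𝒮
  preimage : ∀ m ∈ maps, ∀ R ∈ 𝒮, m ⁻¹' R ∈ 𝒮
  forallBits : ∀ U ∈ 𝒮, ∀ R ∈ 𝒮, forallBits U R ∈ 𝒮
  star : ∀ F b j, ∀ R ∈ 𝒮, star F b j R ∈ 𝒮

/-- One step in the generation of an `OpenFamily`. -/
def familyStep (maps : Set (Orc → Orc)) (𝒯 : Set (Set Orc)) : Set (Set Orc) :=
  𝒯 ∪ image2 (· ∪ ·) 𝒯 𝒯 ∪ image2 (fun m R => m ⁻¹' R) maps 𝒯 ∪ image2 SOA.forallBits 𝒯 𝒯 ∪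
    image2 (fun (p : Finset ℕ × Bool × ℕ) R => SOA.star p.1 p.2.1 p.2.2 R) univ 𝒯

/-- Countably many operations preserve openness, so iterating them ω times keeps the family
countable. -/
theorem exists_openFamily {maps : Set (Orc → Orc)} (hm : maps.Countable)
    (hc : ∀ m ∈ maps, Continuous m) {B : Set (Set Orc)} (hB : B.Countable)
    (hBo : ∀ R ∈ B, IsOpen R) : ∃ 𝒮, OpenFamily maps 𝒮 ∧ B ⊆ 𝒮 := by
  let S : ℕ → Set (Set Orc) := fun n => (familyStep maps)^[n] B
  have hS : ∀ n, S (n + 1) = familyStep maps (S n) := fun n => Function.iterate_succ_apply' ..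
  have hmono : Monotone S := monotone_nat_of_le_succ fun n R hR => by
    rw [hS]; simp [familyStep, hR]
  have hcount : ∀ n, (S n).Countable := by
    intro n
    induction n with
    | zero => exact hB
    | succ n ih =>
      rw [hS]
      exact (((ih.union (ih.image2 ih _)).union (hm.image2 ih _)).union (ih.image2 ih _)).union
        ((to_countable _).image2 ih _)
  have hopen : ∀ n, ∀ R ∈ S n, IsOpen R := by
    intro n
    induction n with
    | zero => exact hBo
    | succ n ih =>
      rw [hS]
      rintro R ((((hR | ⟨U, hU, R, hR, rfl⟩) | ⟨m, hm, R, hR, rfl⟩) | ⟨U, hU, R, hR, rfl⟩) |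
        ⟨p, -, R, hR, rfl⟩)
      · exact ih _ hR
      · exact (ih _ hU).union (ih _ hR)
      · exact (ih _ hR).preimage (hc m hm)
      · exact isOpen_forallBits (ih _ hU) (ih _ hR)
      · exact isOpen_star _ _ _ (ih _ hR)
  refine ⟨⋃ n, S n, ⟨countable_iUnion hcount, ?_, ?_, ?_, ?_, ?_⟩, subset_iUnion S 0⟩
  · intro R hR
    obtain ⟨n, hn⟩ := mem_iUnion.1 hR
    exact hopen n R hn
  · intro U hU R hR
    obtain ⟨n, hn⟩ := mem_iUnion.1 hU
    obtain ⟨k, hk⟩ := mem_iUnion.1 hR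
    refine mem_iUnion.2 ⟨max n k + 1, hS _ ▸ ?_⟩
    exact .inl (.inl (.inl (.inr (mem_image2_of_mem (hmono (le_max_left _ _) hn)
      (hmono (le_max_right _ _) hk)))))
  · intro m hm R hR
    obtain ⟨k, hk⟩ := mem_iUnion.1 hR
    exact mem_iUnion.2 ⟨k + 1, hS _ ▸ .inl (.inl (.inr ⟨m, hm, R, hk, rfl⟩))⟩
  · intro U hU R hR
    obtain ⟨n, hn⟩ := mem_iUnion.1 hU
    obtain ⟨k, hk⟩ := mem_iUnion.1 hR
    refine mem_iUnion.2 ⟨max n k + 1, hS _ ▸ ?_⟩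
    exact .inl (.inr (mem_image2_of_mem (hmono (le_max_left _ _) hn)
      (hmono (le_max_right _ _) hk)))
  · intro F b j R hR
    obtain ⟨k, hk⟩ := mem_iUnion.1 hR
    exact mem_iUnion.2 ⟨k + 1, hS _ ▸ .inr ⟨(F, b, j), mem_univ _, R, hk, rfl⟩⟩

/-- The functions that agree from some point on with one of the functions `L i`. -/
def patches {ι : Type*} (L : ι → Bits) : Set Bits := {l | ∃ i x, ∀ n ≥ x, l n = L i n}

/-- The maps that insert a constant, manipulate a reservoir, or store a new set. -/
inductive IsMap {ι : Type*} (L : ι → Bits) : (Orc → Orc) → Prop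
  | const (l : Bits) (hl : l ∈ patches L) : IsMap L (scons l)
  | inter : IsMap L fun Z =>
      scons (Z 0) (scons (fun n => Z 2 n && Z 1 n) (tail (tail (tail Z))))
  | diff : IsMap L fun Z =>
      scons (Z 0) (scons (fun n => Z 2 n && !Z 1 n) (tail (tail (tail Z))))
  | restrict (E : Finset ℕ) (b : Bool) (j k : ℕ) : IsMap L fun Z =>
      scons (Z 0) (scons (fun n => Z 1 n && decide (k ≤ n ∧ ∀ i ∈ E, Z (j + 2) (npair i n) = b))
        (tail (tail Z)))
  | full : IsMap L fun Z => scons (Z 0) (scons (fun _ => true) (tail Z))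
  | update (i : ℕ) : IsMap L fun Z =>
      scons (Z 0) (Function.update (tail (tail Z)) i (Z 1))

theorem countable_patches {ι : Type*} [Countable ι] (L : ι → Bits) : (patches L).Countable := by
  refine (countable_range fun p : ι × ℕ × Finset ℕ =>
    fun n => if n < p.2.1 then decide (n ∈ p.2.2) else L p.1 n).mono ?_
  rintro l ⟨i, x, h⟩
  refine ⟨(i, x, (Finset.range x).filter fun n => l n = true), ?_⟩
  funext n
  by_cases hn : n < x
  · simp [hn]
  · simp [hn, h n (not_lt.1 hn)]

theorem countable_isMap {ι : Type*} [Countable ι] (L : ι → Bits) :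
    {m | IsMap L m}.Countable := by
  let r : Finset ℕ × Bool × ℕ × ℕ → Orc → Orc := fun p Z =>
    scons (Z 0) (scons (fun n => Z 1 n &&
      decide (p.2.2.2 ≤ n ∧ ∀ i ∈ p.1, Z (p.2.2.1 + 2) (npair i n) = p.2.1)) (tail (tail Z)))
  let u : ℕ → Orc → Orc := fun i Z => scons (Z 0) (Function.update (tail (tail Z)) i (Z 1))
  let c : Fin 3 → Orc → Orc := ![
    fun Z => scons (Z 0) (scons (fun n => Z 2 n && Z 1 n) (tail (tail (tail Z)))),
    fun Z => scons (Z 0) (scons (fun n => Z 2 n && !Z 1 n) (tail (tail (tail Z)))),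
    fun Z => scons (Z 0) (scons (fun _ => true) (tail Z))]
  refine Countable.mono (s₂ := scons '' patches L ∪ (range c ∪ (range r ∪ range u))) ?_
    (((countable_patches L).image _).union
      ((countable_range c).union ((countable_range r).union (countable_range u))))
  rintro m (⟨l, hl⟩ | _ | _ | ⟨E, b, j, k⟩ | _ | i)
  · exact .inl ⟨l, hl, rfl⟩
  · exact .inr (.inl ⟨0, rfl⟩)
  · exact .inr (.inl ⟨1, rfl⟩)
  · exact .inr (.inr (.inl ⟨(E, b, j, k), rfl⟩))
  · exact .inr (.inl ⟨2, rfl⟩)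
  · exact .inr (.inr (.inr ⟨i, rfl⟩))

theorem continuous_bits {X : Type*} [TopologicalSpace X] {f : X → Bits}
    (h : ∀ n, IsClopen {x | f x n = true}) : Continuous f :=
  continuous_pi fun n => continuous_bool_rng true |>.2 (h n)

theorem IsMap.continuous {ι : Type*} {L : ι → Bits} {m : Orc → Orc} (h : IsMap L m) :
    Continuous m := by
  cases h with
  | const l => fun_prop
  | inter =>
    refine continuous_scons (by fun_prop) (continuous_scons (continuous_bits fun n => ?_)
      (by fun_prop))
    simpa [ofPred_and] using (isClopen_bit 2 n true).inter (isClopen_bit 1 n true)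
  | diff =>
    refine continuous_scons (by fun_prop) (continuous_scons (continuous_bits fun n => ?_)
      (by fun_prop))
    simpa [ofPred_and] using (isClopen_bit 2 n true).inter (isClopen_bit 1 n false)
  | restrict E b j k =>
    refine continuous_scons (by fun_prop) (continuous_scons (continuous_bits fun n => ?_)
      (by fun_prop))
    simp only [Bool.and_eq_true, decide_eq_true_eq, ofPred_and]
    exact (isClopen_bit 1 n true).inter (IsClopen.inter ⟨isClosed_const, isOpen_const⟩
      (isClopen_finset_forall E fun i _ => isClopen_bit _ _ _))
  | full => fun_prop
  | update i =>
    refine continuous_scons (by fun_prop) (Continuous.update (by fun_prop) i (by fun_prop))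

/-- Membership in an open set is decided by finitely many values. -/
theorem exists_bound_of_isOpen {R : Set Orc} (hR : IsOpen R) {Z : Orc} (hZ : Z ∈ R) :
    ∃ k, ∀ Z' : Orc, (∀ i < k, ∀ n < k, Z' i n = Z i n) → Z' ∈ R := by
  obtain ⟨I, u, hu, hI⟩ := isOpen_pi_iff.1 hR Z hZ
  have : ∀ i, ∃ J : Finset ℕ, i ∈ I → ∀ Y : Bits, (∀ n ∈ J, Y n = Z i n) → Y ∈ u i := by
    intro i
    by_cases hi : i ∈ I
    · obtain ⟨J, v, hv, hJ⟩ := isOpen_pi_iff.1 (hu i hi).1 (Z i) (hu i hi).2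
      exact ⟨J, fun _ Y hY => hJ fun n hn => by rw [hY n hn]; exact (hv n hn).2⟩
    · exact ⟨∅, fun h => (hi h).elim⟩
  choose J hJ using this
  refine ⟨I.sup id + (I.sup fun i => (J i).sup id) + 1, fun Z' h => hI fun i hi => hJ i hi _ ?_⟩
  intro n hn
  have h1 : i ≤ I.sup id := Finset.le_sup (f := id) hi
  have h2 : n ≤ (J i).sup id := Finset.le_sup (f := id) hn
  have h3 : (J i).sup id ≤ I.sup fun i => (J i).sup id :=
    Finset.le_sup (f := fun i => (J i).sup id) hi
  exact h i (by omega) n (by omega)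

/-! ## Fair sequences of sets -/

/-- A sequence of conditions that meets countably many requirements. -/
theorem exists_generic_sequence {P I : Type*} [Countable I] {r : P → P → Prop}
    (hrefl : ∀ p, r p p) (htrans : ∀ p q u, r p q → r q u → r p u) {D : I → P → Prop}
    (h : ∀ i p, ∃ q, r q p ∧ D i q) (p₀ : P) :
    ∃ c : ℕ → P, c 0 = p₀ ∧ (∀ m n, m ≤ n → r (c n) (c m)) ∧ ∀ i, ∃ n, D i (c n) := by
  rcases isEmpty_or_nonempty I with hI | hI
  · exact ⟨fun _ => p₀, rfl, fun _ _ _ => hrefl _, fun i => (hI.false i).elim⟩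
  obtain ⟨e, he⟩ := exists_surjective_nat I
  choose f hf hD using h
  let c : ℕ → P := fun n => Nat.rec p₀ (fun n p => f (e n) p) n
  refine ⟨c, rfl, fun m n hmn => ?_, fun i => ?_⟩
  · induction n, hmn using Nat.le_induction with
    | base => exact hrefl _
    | succ n _ ih => exact htrans _ _ _ (hf _ _) ih
  · obtain ⟨n, rfl⟩ := he i
    exact ⟨n + 1, hD _ _⟩

/-- Replace the values of `l` below `x` by those of `A`. -/
def patch (A : Bits) (x : ℕ) (l : Bits) : Bits := fun n => if n < x then A n else l n

/-- The sequences whose first entry does not begin with `σ₀, …, σₖ₋₁`. -/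
def offCylinder (σ : Bits) (k : ℕ) : Set Orc := {Z | ∃ n < k, Z 0 n ≠ σ n}

section Fair

variable {ι : Type*} (𝒮 : Set (Set Orc)) (L : ι → Bits) (A : Bits)

theorem patch_mem_patches (x : ℕ) (i : ι) : patch A x (L i) ∈ patches L :=
  ⟨i, x, fun n hn => by simp [patch, not_lt.2 hn]⟩

/-- Every set of at most `N` numbers is contained in `L i` for some `i ∈ s`. -/
def Covers (N : ℕ) (s : Finset ι) : Prop :=
  ∀ Y : Finset ℕ, Y.card ≤ N → ∃ i ∈ s, ∀ y ∈ Y, L i y = true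

variable {L} in
theorem Covers.mono {N : ℕ} {s t : Finset ι} (h : Covers L N s) (hst : s ⊆ t) : Covers L N t :=
  fun Y hY => (h Y hY).imp fun _ hi => ⟨hst hi.1, hi.2⟩

/-- A set in `𝒮` that does not contain `A, C` avoids also `L', C` for sufficiently many
finite modifications `L'` of the `L i` with `i ∈ s`. -/
def Fair (C : Orc) (s : Finset ι) (N : ℕ) : Prop :=
  ∀ R ∈ 𝒮, scons A C ∉ R → ∃ s' ⊆ s, Covers L N s' ∧
    ∀ i ∈ s', ∃ x, scons (patch A x (L i)) C ∉ R

/-- `C'` is fair whenever `C` is. -/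
def Keeps (C C' : Orc) : Prop := ∀ s N, Fair 𝒮 L A C s N → Fair 𝒮 L A C' s N

variable {𝒮 L A}

theorem Keeps.trans {C₁ C₂ C₃ : Orc} (h₁ : Keeps 𝒮 L A C₁ C₂) (h₂ : Keeps 𝒮 L A C₂ C₃) :
    Keeps 𝒮 L A C₁ C₃ := fun s N h => h₂ s N (h₁ s N h)

/-- Pulling a set of `𝒮` back along `m` turns a question about `C'` into one about `C`, uniformly in
the first entry. -/
theorem OpenFamily.keeps (h𝒮 : OpenFamily {m | IsMap L m} 𝒮) {m : Orc → Orc} (hm : IsMap L m)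
    {C C' : Orc} (h : ∀ l, m (scons l C) = scons l C') : Keeps 𝒮 L A C C' := by
  intro s N hF R hR hA
  have := hF _ (h𝒮.preimage m hm R hR) (by simpa [h] using hA)
  simpa [h] using this

/-- The closed class outside `U` is shrunk once so that it decides `R`: either all its members put
`A` into `R`, or all keep enough modified `L i` out of `R`. -/
theorem OpenFamily.exists_decides (h𝒮 : OpenFamily {m | IsMap L m} 𝒮)
    (hcyl : ∀ σ k, offCylinder σ k ∈ 𝒮) {C : Orc} {U R : Set Orc} (hU : U ∈ 𝒮) (hR : R ∈ 𝒮)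
    (hne : ∃ Y, scons Y C ∉ U) {s : Finset ι} {N : ℕ} (hs : Fair 𝒮 L A C s N) :
    ∃ U' ∈ 𝒮, U ⊆ U' ∧ (∃ Y, scons Y C ∉ U') ∧
      ((∀ Y, scons Y C ∉ U' → scons A (scons Y C) ∈ R) ∨
        ∃ s' ⊆ s, Covers L N s' ∧ ∀ i ∈ s', ∃ x, ∀ Y, scons Y C ∉ U' →
          scons (patch A x (L i)) (scons Y C) ∉ R) := by
  classical
  by_cases h1 : ∃ Y, scons Y C ∉ U ∧ scons A (scons Y C) ∈ R
  · obtain ⟨Y, hY, hYR⟩ := h1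
    obtain ⟨k, hk⟩ := exists_bound_of_isOpen (h𝒮.isOpen R hR) hYR
    -- `R` is open, so restricting the class to a cylinder around `Y` makes membership permanent.
    refine ⟨U ∪ offCylinder Y k, h𝒮.union _ hU _ (hcyl _ _), subset_union_left, ⟨Y, ?_⟩, .inl ?_⟩
    · simp [hY, offCylinder]
    · intro Y' hY'
      simp only [mem_union, offCylinder, mem_ofPred_eq, scons_zero, not_or, not_exists, not_and,
        not_not] at hY'
      refine hk _ fun i _ n hn => ?_
      rcases i with _ | _ | i
      exacts [rfl, hY'.2 n hn, rfl]
  · push Not at h1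
    -- The set `u` collects the indices that the current class already keeps out of `R`; the
    -- induction is on the number of remaining indices in `s`.
    suffices H : ∀ d, ∀ u ⊆ s, (s \ u).card = d → ∀ U ∈ 𝒮, (∃ Y, scons Y C ∉ U) →
        (∀ Y, scons Y C ∉ U → scons A (scons Y C) ∉ R) →
        (∀ i ∈ u, ∃ x, ∀ Y, scons Y C ∉ U → scons (patch A x (L i)) (scons Y C) ∉ R) →
        ∃ U' ∈ 𝒮, U ⊆ U' ∧ (∃ Y, scons Y C ∉ U') ∧ ∃ s' ⊆ s, Covers L N s' ∧
          ∀ i ∈ s', ∃ x, ∀ Y, scons Y C ∉ U' → scons (patch A x (L i)) (scons Y C) ∉ R by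
      obtain ⟨U', h, h', h'', h'''⟩ := H _ ∅ (by simp) rfl U hU hne h1 (by simp)
      exact ⟨U', h, h', h'', .inr h'''⟩
    intro d
    induction d with
    | zero =>
      intro u hu hd U hU hne hA hL
      obtain rfl : u = s := Finset.Subset.antisymm hu (by simpa using hd)
      obtain ⟨Y, hY⟩ := hne
      have hQ := hs _ (h𝒮.forallBits U hU R hR) fun h => by
        rcases h Y with h | h
        exacts [hY h, hA Y hY h]
      obtain ⟨s', hs', hc, -⟩ := hQ
      exact ⟨U, hU, Subset.rfl, ⟨Y, hY⟩, u, Finset.Subset.rfl, hc.mono hs', hL⟩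
    | succ d ih =>
      intro u hu hd U hU hne hA hL
      by_cases huc : Covers L N u
      · exact ⟨U, hU, Subset.rfl, hne, u, hu, huc, hL⟩
      obtain ⟨Y, hY⟩ := hne
      -- Fairness of `C` is applied to an open set that no longer mentions a particular `Y`. It
      -- provides a covering family, and this contains a new index as long as `u` does not cover.
      have hQ := hs _ (h𝒮.forallBits U hU R hR) fun h => by
        rcases h Y with h | h
        exacts [hY h, hA Y hY h]
      obtain ⟨s', hs', hc, hx⟩ := hQ
      obtain ⟨i, his', hiu⟩ : ∃ i ∈ s', i ∉ u := by
        by_contra! hcon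
        exact huc (hc.mono hcon)
      obtain ⟨x, hx⟩ := hx i his'
      simp only [SOA.forallBits, mem_ofPred_eq, not_forall, not_or, tail_scons, scons_zero] at hx
      obtain ⟨Y', hY'U, hY'R⟩ := hx
      -- The class is cut down to the members that keep the modified `L i` out of `R`; `Y'` shows
      -- that it stays nonempty.
      have hU' := h𝒮.union _ hU _ (h𝒮.preimage _ (.const _ (patch_mem_patches L A x i)) R hR)
      obtain ⟨U'', h1, h2, h3⟩ := ih (insert i u) (Finset.insert_subset (hs' his') hu)
        (by
          have h := Finset.card_sdiff_add_card_eq_card hu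
          have h' := Finset.card_sdiff_add_card_eq_card (Finset.insert_subset (hs' his') hu)
          rw [Finset.card_insert_of_notMem hiu] at h'
          omega) _ hU' ⟨Y', by simp [hY'U, hY'R]⟩
        (fun Y hY => hA Y fun h => hY (.inl h)) (by
          intro i' hi'
          rcases Finset.mem_insert.1 hi' with rfl | hi'
          · exact ⟨x, fun Y hY h => hY (.inr h)⟩
          · obtain ⟨x', hx'⟩ := hL i' hi'
            exact ⟨x', fun Y hY => hx' Y fun h => hY (.inl h)⟩)
      exact ⟨U'', h1, fun Z hZ => h2 (.inl hZ), h3⟩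

/-- A basis theorem: fairness is preserved by some member of each nonempty closed class. -/
theorem OpenFamily.exists_keeps [Countable ι] (h𝒮 : OpenFamily {m | IsMap L m} 𝒮)
    (hcyl : ∀ σ k, offCylinder σ k ∈ 𝒮) {C : Orc} {U : Set Orc} (hU : U ∈ 𝒮)
    (hne : ∃ Y, scons Y C ∉ U) : ∃ Y, scons Y C ∉ U ∧ Keeps 𝒮 L A C (scons Y C) := by
  let P := {U : Set Orc // U ∈ 𝒮 ∧ ∃ Y, scons Y C ∉ U}
  let I := {q : Set Orc × Finset ι × ℕ // q.1 ∈ 𝒮 ∧ Fair 𝒮 L A C q.2.1 q.2.2}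
  have : Countable I := by
    have := h𝒮.countable.to_subtype
    let f : I → 𝒮 × Finset ι × ℕ := fun q => (⟨q.1.1, q.2.1⟩, q.1.2)
    refine Function.Injective.countable (f := f) fun q q' h => ?_
    simp only [f, Prod.mk.injEq, Subtype.mk.injEq] at h
    exact Subtype.ext (Prod.ext h.1 h.2)
  obtain ⟨c, hc0, hmono, hD⟩ := exists_generic_sequence (P := P) (I := I)
    (r := fun p q => q.1 ⊆ p.1) (D := fun q p =>
      (∀ Y, scons Y C ∉ p.1 → scons A (scons Y C) ∈ q.1.1) ∨
        ∃ s' ⊆ q.1.2.1, Covers L q.1.2.2 s' ∧ ∀ i ∈ s', ∃ x, ∀ Y, scons Y C ∉ p.1 →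
          scons (patch A x (L i)) (scons Y C) ∉ q.1.1)
    (fun _ => Subset.rfl) (fun _ _ _ h h' => h'.trans h)
    (fun q p => by
      obtain ⟨U', h1, h2, h3, h4⟩ := h𝒮.exists_decides hcyl p.2.1 q.2.1 p.2.2 q.2.2
      exact ⟨⟨U', h1, h3⟩, h2, h4⟩) ⟨U, hU, hne⟩
  let K : ℕ → Set Bits := fun n => {Y | scons Y C ∉ (c n).1}
  have hK : ∀ n, IsClosed (K n) := fun n => by
    have h1 : IsOpen ((fun Y : Bits => scons Y C) ⁻¹' (c n).1) :=
      (h𝒮.isOpen _ (c n).2.1).preimage (by fun_prop)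
    exact h1.isClosed_compl
  -- Compactness gives a common member of the decreasing classes, which inherits all the decisions.
  obtain ⟨Y, hY⟩ := IsCompact.nonempty_iInter_of_sequence_nonempty_isCompact_isClosed K
    (fun n Y hY h => hY (hmono n (n + 1) (Nat.le_succ n) h)) (fun n => (c n).2.2)
    (hK 0).isCompact hK
  rw [mem_iInter] at hY
  refine ⟨Y, by simpa [K, hc0] using hY 0, fun s N hs R hR hA => ?_⟩
  obtain ⟨n, h | ⟨s', h1, h2, h3⟩⟩ := hD ⟨(R, s, N), hR, hs⟩
  · exact (hA (h Y (hY n))).elim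
  · exact ⟨s', h1, h2, fun i hi => (h3 i hi).imp fun x hx => hx Y (hY n)⟩

end Fair

/-! ## Ramsey's theorem for pairs -/

/-- The numbers whose pairs with almost all larger numbers have the color `b`. -/
def limitClass (g : Bits) (b : Bool) : Set ℕ :=
  {i | ∀ᶠ n in (hyperfilter ℕ : Filter ℕ), g (npair i n) = b}

/-- The ultrafilter gives every number a limit color even if the coloring is not stable, so no
cohesive set has to be built beforehand. -/
theorem mem_limitClass_or (g : Bits) (b : Bool) (i : ℕ) :
    i ∈ limitClass g b ∨ i ∈ limitClass g (!b) := by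
  have h : ∀ᶠ n in (hyperfilter ℕ : Filter ℕ), g (npair i n) = b ∨ g (npair i n) = !b :=
    .of_forall fun n => by cases b <;> cases g (npair i n) <;> simp
  exact Ultrafilter.eventually_or.1 h

theorem infinite_of_mem_hyperfilter {s : Set ℕ} (h : s ∈ (hyperfilter ℕ : Filter ℕ)) :
    s.Infinite := fun hf => notMem_hyperfilter_of_finite hf h

/-- A Mathias condition for a pair of homogeneous sets. -/
structure RamseyCond (C : Orc) where
  /-- the finite parts -/
  F : Bool → Finset ℕ
  /-- the reservoir -/
  X : Bits

section Ramsey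

variable {ι : Type*} (𝒮 : Set (Set Orc)) (L : ι → Bits) (A : Bits) {C : Orc} {j : ℕ}

/-- The condition is compatible with the coloring `C j`, and its reservoir preserves fairness. -/
structure RamseyCond.Valid (j : ℕ) (p : RamseyCond C) : Prop where
  mem : ∀ᶠ n in (hyperfilter ℕ : Filter ℕ), p.X n = true
  keeps : Keeps 𝒮 L A C (scons p.X C)
  homog : ∀ b, Homog (C j) b ↑(p.F b)
  compat : ∀ b, ∀ i ∈ p.F b, ∀ n, p.X n = true → i < n ∧ C j (npair i n) = b

variable {𝒮 L A}

/-- `q` extends `p`. -/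
structure RamseyCond.Le (q p : RamseyCond C) : Prop where
  subset : ∀ b, p.F b ⊆ q.F b
  reservoir : ∀ n, q.X n = true → p.X n = true
  new : ∀ b, ∀ n ∈ q.F b, n ∈ p.F b ∨ p.X n = true

theorem RamseyCond.Le.refl (p : RamseyCond C) : p.Le p :=
  ⟨fun _ => Finset.Subset.rfl, fun _ h => h, fun _ _ h => .inl h⟩

theorem RamseyCond.Le.trans {p q r : RamseyCond C} (h : r.Le q) (h' : q.Le p) : r.Le p :=
  ⟨fun b => (h'.subset b).trans (h.subset b), fun n hn => h'.reservoir n (h.reservoir n hn),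
    fun b n hn => (h.new b n hn).elim (h'.new b n) fun hn => .inr (h'.reservoir n hn)⟩

/-- The sets that are compatible with the condition on the side `b`. -/
structure RamseyCond.Between (p : RamseyCond C) (b : Bool) (G : Bits) : Prop where
  subset : ∀ n ∈ p.F b, G n = true
  new : ∀ n, G n = true → n ∈ p.F b ∨ p.X n = true

/-- All compatible sets belong to `R`. -/
def RamseyCond.Met (A : Bits) (p : RamseyCond C) (b : Bool) (R : Set Orc) : Prop :=
  ∀ G, p.Between b G → scons A (scons G C) ∈ R

/-- No compatible homogeneous set belongs to `R` with suitable modifications of the `L i`. -/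
def RamseyCond.Avoids (L : ι → Bits) (A : Bits) (j : ℕ) (p : RamseyCond C) (b : Bool)
    (R : Set Orc) (s : Finset ι) (N : ℕ) : Prop :=
  ∃ s' ⊆ s, Covers L N s' ∧ ∀ i ∈ s', ∃ x, ∀ G, p.Between b G → Homog (C j) b {n | G n = true} →
    scons (patch A x (L i)) (scons G C) ∉ R

/-- No finite set compatible with `F`, `X` and `b` belongs to `R`. -/
def NoFinite (C : Orc) (j : ℕ) (F : Finset ℕ) (X : Bits) (b : Bool) (R : Set Orc) (l : Bits) :
    Prop :=
  ∀ E : Finset ℕ, (∀ n ∈ E, X n = true) → Homog (C j) b ↑(F ∪ E) →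
    scons l (scons (finBits (F ∪ E)) C) ∉ R

/-- Since `R` is open, membership would already be witnessed by `F` together with a finite part of
`G`. -/
theorem NoFinite.notMem {F : Finset ℕ} {X : Bits} {b : Bool} {R : Set Orc} {l : Bits}
    (h : NoFinite C j F X b R l) (hR : IsOpen R) {G : Bits} (hF : ∀ n ∈ F, G n = true)
    (hG : ∀ n, G n = true → n ∈ F ∨ X n = true) (hh : Homog (C j) b {n | G n = true}) :
    scons l (scons G C) ∉ R := by
  classical
  intro hmem
  obtain ⟨k, hk⟩ := exists_bound_of_isOpen hR hmem
  let E := (Finset.range k).filter fun n => G n = true ∧ n ∉ F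
  have hsub : ∀ n ∈ F ∪ E, G n = true := by
    intro n hn
    rcases Finset.mem_union.1 hn with hn | hn
    · exact hF n hn
    · exact (Finset.mem_filter.1 hn).2.1
  refine h E (fun n hn => ?_) (hh.mono fun n hn => hsub n hn) (hk _ fun i _ n hn => ?_)
  · have := (Finset.mem_filter.1 hn).2
    exact (hG n this.1).resolve_left this.2
  · rcases i with _ | _ | i
    · rfl
    · simp only [scons_succ, scons_zero, finBits]
      by_cases hGn : G n = true
      · by_cases hnF : n ∈ F <;> simp [hGn, hnF, E, hn]
      · have : n ∉ F ∪ E := fun h => hGn (hsub n h)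
        simp [this, Bool.not_eq_true _ ▸ hGn]
    · rfl

theorem NoFinite.mono {F : Finset ℕ} {X X' : Bits} {b : Bool} {R : Set Orc} {l : Bits}
    (h : NoFinite C j F X b R l) (hX : ∀ n, X' n = true → X n = true) :
    NoFinite C j F X' b R l := fun E hE => h E fun n hn => hX n (hE n hn)

/-- Each element of `E` has limit color `b`, so the numbers that have color `b` with all of `E`
belong to the ultrafilter. Passing to them is one of the maps of `IsMap`, so fairness is kept. -/
theorem RamseyCond.Valid.extend (h𝒮 : OpenFamily {m | IsMap L m} 𝒮) {p : RamseyCond C}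
    (hp : p.Valid 𝒮 L A j) (b : Bool) {E : Finset ℕ} (hE : ∀ n ∈ E, p.X n = true)
    (hEb : ∀ n ∈ E, n ∈ limitClass (C j) b) (hEh : Homog (C j) b ↑(p.F b ∪ E)) (k : ℕ) :
    ∃ q : RamseyCond C, q.Valid 𝒮 L A j ∧ q.Le p ∧ q.F b = p.F b ∪ E ∧
      ∀ n, q.X n = true → k ≤ n := by
  -- The second bound puts the new reservoir above `E`; the first lets the caller freeze the sets
  -- below `k`.
  let K := max k (E.sup id + 1)
  let X : Bits := fun n => p.X n && decide (K ≤ n ∧ ∀ i ∈ E, C j (npair i n) = b)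
  have hX : ∀ n, X n = true ↔ p.X n = true ∧ K ≤ n ∧ ∀ i ∈ E, C j (npair i n) = b := by
    simp [X]
  refine ⟨⟨fun c => if c = b then p.F b ∪ E else p.F c, X⟩, ⟨?_, ?_, ?_, ?_⟩, ⟨?_, ?_, ?_⟩, ?_, ?_⟩
  · have h1 : ∀ᶠ n in (hyperfilter ℕ : Filter ℕ), K ≤ n :=
      Nat.hyperfilter_le_atTop (eventually_ge_atTop K)
    have h2 : ∀ᶠ n in (hyperfilter ℕ : Filter ℕ), ∀ i ∈ E, C j (npair i n) = b :=
      (eventually_all_finset E).2 hEb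
    filter_upwards [hp.mem, h1, h2] with n a1 a2 a3
    exact (hX n).2 ⟨a1, a2, a3⟩
  · exact hp.keeps.trans (h𝒮.keeps (.restrict E b j K) fun l => rfl)
  · intro c
    by_cases hc : c = b
    · subst hc; simpa using hEh
    · simpa [hc] using hp.homog c
  · intro c i hi n hn
    obtain ⟨h1, h2, h3⟩ := (hX n).1 hn
    by_cases hc : c = b
    · subst hc
      simp only [if_true] at hi
      rcases Finset.mem_union.1 hi with hi | hi
      · exact hp.compat c i hi n h1
      · have : i ≤ E.sup id := Finset.le_sup (f := id) hi
        exact ⟨by omega, h3 i hi⟩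
    · exact hp.compat c i (by simpa [hc] using hi) n h1
  · intro c
    by_cases hc : c = b
    · subst hc; simp
    · simp [hc]
  · exact fun n hn => ((hX n).1 hn).1
  · intro c n hn
    by_cases hc : c = b
    · subst hc
      simp only [if_true] at hn
      exact (Finset.mem_union.1 hn).imp id (hE n)
    · exact .inl (by simpa [hc] using hn)
  · simp
  · exact fun n hn => (le_max_left _ _).trans ((hX n).1 hn).2.1

theorem RamseyCond.Valid.exists_met (h𝒮 : OpenFamily {m | IsMap L m} 𝒮) {p : RamseyCond C}
    (hp : p.Valid 𝒮 L A j) (b : Bool) {R : Set Orc} (hR : R ∈ 𝒮) {E : Finset ℕ}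
    (hE : ∀ n ∈ E, p.X n = true) (hEb : ∀ n ∈ E, n ∈ limitClass (C j) b)
    (hEh : Homog (C j) b ↑(p.F b ∪ E)) (hER : scons A (scons (finBits (p.F b ∪ E)) C) ∈ R) :
    ∃ q : RamseyCond C, q.Valid 𝒮 L A j ∧ q.Le p ∧ q.Met A b R := by
  obtain ⟨k, hk⟩ := exists_bound_of_isOpen (h𝒮.isOpen R hR) hER
  obtain ⟨q, hq, hqp, hqF, hqX⟩ := hp.extend h𝒮 b hE hEb hEh k
  refine ⟨q, hq, hqp, fun G hG => hk _ fun i _ n hn => ?_⟩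
  rcases i with _ | _ | i
  · rfl
  · simp only [scons_succ, scons_zero, finBits, ← hqF]
    by_cases hnF : n ∈ q.F b
    · simp [hnF, hG.subset n hnF]
    · have : G n ≠ true := fun h => by
        rcases hG.new n h with h | h
        · exact hnF h
        · exact absurd (hqX n h) (by omega)
      simp [hnF, this]
  · rfl

/-- If the whole reservoir has limit color `b`, every finite homogeneous extension is admissible.
Fairness can then be applied to `star` directly, and no part of the cover is lost. -/
theorem RamseyCond.Valid.decides_of_subset (h𝒮 : OpenFamily {m | IsMap L m} 𝒮)
    {p : RamseyCond C} (hp : p.Valid 𝒮 L A j) {b : Bool}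
    (hb : ∀ n, p.X n = true → n ∈ limitClass (C j) b) {R : Set Orc} (hR : R ∈ 𝒮)
    {s : Finset ι} {N : ℕ} (hs : Fair 𝒮 L A C s N) :
    ∃ q : RamseyCond C, q.Valid 𝒮 L A j ∧ q.Le p ∧ (q.Met A b R ∨ q.Avoids L A j b R s N) := by
  by_cases hA : scons A (scons p.X C) ∈ star (p.F b) b j R
  · obtain ⟨E, hE, hEh, hER⟩ := hA
    obtain ⟨q, hq, hqp, hm⟩ := hp.exists_met h𝒮 b hR hE (fun n hn => hb n (hE n hn)) hEh hER
    exact ⟨q, hq, hqp, .inl hm⟩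
  · obtain ⟨s', hs', hc, hx⟩ := hp.keeps s N hs _ (h𝒮.star _ _ _ R hR) hA
    refine ⟨p, hp, .refl p, .inr ⟨s', hs', hc, fun i hi => ?_⟩⟩
    obtain ⟨x, hx⟩ := hx i hi
    refine ⟨x, fun G hG hh => NoFinite.notMem (j := j) (F := p.F b) (X := p.X) (b := b) ?_
      (h𝒮.isOpen R hR) hG.subset hG.new hh⟩
    exact fun E hE hEh hER => hx ⟨E, hE, hEh, hER⟩

/-- The limit classes need not be available to `𝒮`, so the question is asked for all splittings of
the reservoir. If every splitting admits an extension, so does the true one; otherwise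
counterexample splittings are used to thin the reservoir. -/
theorem RamseyCond.Valid.decides [Countable ι] (h𝒮 : OpenFamily {m | IsMap L m} 𝒮)
    (hcyl : ∀ σ k, offCylinder σ k ∈ 𝒮) {p : RamseyCond C} (hp : p.Valid 𝒮 L A j)
    {R : Bool → Set Orc} (hR : ∀ b, R b ∈ 𝒮) {s : Finset ι} {N : Bool → ℕ}
    (hs : Fair 𝒮 L A C s (N true + N false)) :
    ∃ q : RamseyCond C, q.Valid 𝒮 L A j ∧ q.Le p ∧
      ∃ b, q.Met A b (R b) ∨ q.Avoids L A j b (R b) s (N b) := by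
  classical
  -- Here `Z 1` splits the reservoir `Z 2`: one of the halves contains an extension that meets the
  -- requirement of its color.
  let W : Set Orc := (fun Z : Orc =>
      scons (Z 0) (scons (fun n => Z 2 n && Z 1 n) (tail (tail (tail Z))))) ⁻¹'
        star (p.F true) true j (R true) ∪
    (fun Z : Orc => scons (Z 0) (scons (fun n => Z 2 n && !Z 1 n) (tail (tail (tail Z))))) ⁻¹'
        star (p.F false) false j (R false)
  have hW : W ∈ 𝒮 := h𝒮.union _ (h𝒮.preimage _ .inter _ (h𝒮.star _ _ _ _ (hR _))) _
    (h𝒮.preimage _ .diff _ (h𝒮.star _ _ _ _ (hR _)))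
  have h0 : (∅ : Set Orc) ∈ 𝒮 := by
    have := hcyl (fun _ => true) 0
    simpa [offCylinder] using this
  by_cases hA : scons A (scons p.X C) ∈ SOA.forallBits ∅ W
  · let B : Bits := fun n => decide (n ∈ limitClass (C j) true)
    rcases (hA B).resolve_left (notMem_empty _) with h | h <;> obtain ⟨E, hE, hEh, hER⟩ := h
    · have hE' : ∀ n ∈ E, p.X n = true ∧ n ∈ limitClass (C j) true := by simpa [B] using hE
      obtain ⟨q, hq, hqp, hm⟩ := hp.exists_met h𝒮 true (hR true) (fun n hn => (hE' n hn).1)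
        (fun n hn => (hE' n hn).2) hEh hER
      exact ⟨q, hq, hqp, true, .inl hm⟩
    · have hE' : ∀ n ∈ E, p.X n = true ∧ n ∉ limitClass (C j) true := by simpa [B] using hE
      obtain ⟨q, hq, hqp, hm⟩ := hp.exists_met h𝒮 false (hR false) (fun n hn => (hE' n hn).1)
        (fun n hn => (mem_limitClass_or (C j) true n).resolve_left (hE' n hn).2) hEh hER
      exact ⟨q, hq, hqp, false, .inl hm⟩
  · obtain ⟨s', hs', hc, hx⟩ := hp.keeps _ _ hs _ (h𝒮.forallBits _ h0 _ hW) hA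
    -- The indices are treated one by one: the basis theorem picks a bad splitting that keeps
    -- fairness, and the ultrafilter picks the half that survives.
    have key : ∀ t ⊆ s', ∃ X : Bits, (∀ᶠ n in (hyperfilter ℕ : Filter ℕ), X n = true) ∧
        Keeps 𝒮 L A C (scons X C) ∧ (∀ n, X n = true → p.X n = true) ∧
        ∀ i ∈ t, ∃ b x, NoFinite C j (p.F b) X b (R b) (patch A x (L i)) := by
      intro t
      induction t using Finset.induction with
      | empty => exact fun _ => ⟨p.X, hp.mem, hp.keeps, fun _ h => h, by simp⟩
      | insert i t _ ih =>
        intro ht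
        obtain ⟨X, hX, hk, hXp, hXt⟩ := ih fun i hi => ht (Finset.mem_insert_of_mem hi)
        obtain ⟨x, hx⟩ := hx i (ht (Finset.mem_insert_self _ _))
        -- A bad splitting of `p.X` is also one of the smaller reservoir `X`.
        have : ∃ Y, scons Y (scons X C) ∉ scons (patch A x (L i)) ⁻¹' W := by
          simp only [SOA.forallBits, mem_ofPred_eq, not_forall, not_or] at hx
          obtain ⟨Y, -, hY⟩ := hx
          refine ⟨Y, fun h => hY (h.imp ?_ ?_)⟩ <;> rintro ⟨E, hE, hEh, hER⟩ <;>
            refine ⟨E, fun n hn => ?_, hEh, hER⟩ <;>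
            have := hE n hn <;> simp at this ⊢ <;> exact ⟨hXp n this.1, this.2⟩
        obtain ⟨Y, hYW, hYk⟩ := h𝒮.exists_keeps hcyl
          (h𝒮.preimage _ (.const _ (patch_mem_patches L A x i)) W hW) this
        have hY1 : NoFinite C j (p.F true) (fun n => X n && Y n) true (R true)
            (patch A x (L i)) := fun E hE hEh hER => hYW (.inl ⟨E, hE, hEh, hER⟩)
        have hY2 : NoFinite C j (p.F false) (fun n => X n && !Y n) false (R false)
            (patch A x (L i)) := fun E hE hEh hER => hYW (.inr ⟨E, hE, hEh, hER⟩)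
        have hor : ∀ᶠ n in (hyperfilter ℕ : Filter ℕ), (X n && Y n) = true ∨
            (X n && !Y n) = true := by
          filter_upwards [hX] with n hn
          cases Y n <;> simp [hn]
        rcases Ultrafilter.eventually_or.1 hor with hor | hor
        · refine ⟨fun n => X n && Y n, hor, (hk.trans hYk).trans
            (h𝒮.keeps .inter fun l => rfl), fun n hn => hXp n (by simp at hn; exact hn.1), ?_⟩
          intro i' hi'
          rcases Finset.mem_insert.1 hi' with rfl | hi'
          · exact ⟨true, x, hY1⟩
          · obtain ⟨b, x', h⟩ := hXt i' hi'
            exact ⟨b, x', h.mono fun n hn => by simp at hn; exact hn.1⟩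
        · refine ⟨fun n => X n && !Y n, hor, (hk.trans hYk).trans
            (h𝒮.keeps .diff fun l => rfl), fun n hn => hXp n (by simp at hn; exact hn.1), ?_⟩
          intro i' hi'
          rcases Finset.mem_insert.1 hi' with rfl | hi'
          · exact ⟨false, x, hY2⟩
          · obtain ⟨b, x', h⟩ := hXt i' hi'
            exact ⟨b, x', h.mono fun n hn => by simp at hn; exact hn.1⟩
    obtain ⟨X, hX, hk, hXp, hXs⟩ := key s' Finset.Subset.rfl
    refine ⟨⟨p.F, X⟩, ⟨hX, hk, hp.homog, fun b i hi n hn => hp.compat b i hi n (hXp n hn)⟩,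
      ⟨fun _ => Finset.Subset.rfl, hXp, fun _ _ h => .inl h⟩, ?_⟩
    let s'' : Bool → Finset ι := fun b =>
      s'.filter fun i => ∃ x, NoFinite C j (p.F b) X b (R b) (patch A x (L i))
    -- If `Y1` and `Y2` were uncovered on their sides, their union would still lie in some `L i`
    -- with `i ∈ s'`, and this `i` belongs to one of the sides.
    obtain ⟨b, hb⟩ : ∃ b, Covers L (N b) (s'' b) := by
      by_contra! hcon
      have h1 := hcon true
      have h2 := hcon false
      simp only [Covers, not_forall, not_exists, not_and] at h1 h2
      obtain ⟨Y1, hc1, h1⟩ := h1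
      obtain ⟨Y2, hc2, h2⟩ := h2
      obtain ⟨i, hi, hY⟩ := hc (Y1 ∪ Y2) ((Finset.card_union_le _ _).trans (by omega))
      obtain ⟨b, x, h⟩ := hXs i hi
      have hmem : i ∈ s'' b := Finset.mem_filter.2 ⟨hi, x, h⟩
      cases b
      · obtain ⟨y, hy, h⟩ := h2 i hmem
        exact h (hY y (Finset.mem_union_right _ hy))
      · obtain ⟨y, hy, h⟩ := h1 i hmem
        exact h (hY y (Finset.mem_union_left _ hy))
    refine ⟨b, .inr ⟨s'' b, (Finset.filter_subset _ _).trans hs', hb, fun i hi => ?_⟩⟩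
    obtain ⟨x, hx⟩ := (Finset.mem_filter.1 hi).2
    exact ⟨x, fun G hG hh => hx.notMem (h𝒮.isOpen _ (hR b)) hG.subset hG.new hh⟩

end Ramsey

end SOA

namespace SOA

open Set Filter Topology

/-! ### Generic homogeneous sets. -/

section RamseyTheorem

variable {ι : Type*} {𝒮 : Set (Set Orc)} {L : ι → Bits} {A : Bits} {C : Orc} {j : ℕ}

theorem RamseyCond.Valid.exists_mem (h𝒮 : OpenFamily {m | IsMap L m} 𝒮) {p : RamseyCond C}
    (hp : p.Valid 𝒮 L A j) {b : Bool} {n : ℕ} (hn : p.X n = true)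
    (hb : n ∈ limitClass (C j) b) :
    ∃ q : RamseyCond C, q.Valid 𝒮 L A j ∧ q.Le p ∧ n ∈ q.F b := by
  obtain ⟨q, hq, hqp, hF, -⟩ := hp.extend h𝒮 b (E := {n}) (by simpa using hn) (by simpa using hb)
    (by
      intro x hx y hy hxy
      simp only [Finset.coe_union, Finset.coe_singleton, mem_union, Finset.mem_coe,
        mem_singleton_iff] at hx hy
      rcases hx with hx | rfl <;> rcases hy with hy | rfl
      · exact hp.homog b x hx y hy hxy
      · exact (hp.compat b x hx _ hn).2
      · exact absurd (hp.compat b y hy _ hn).1 (by omega)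
      · omega) 0
  exact ⟨q, hq, hqp, by simp [hF]⟩

/-- The union of the finite parts of a sequence of conditions. -/
noncomputable def unionBits (c : ℕ → RamseyCond C) (b : Bool) : Bits :=
  open Classical in fun n => decide (∃ m, n ∈ (c m).F b)

theorem unionBits_eq_true {c : ℕ → RamseyCond C} {b : Bool} {n : ℕ} :
    unionBits c b n = true ↔ ∃ m, n ∈ (c m).F b := by
  simp [unionBits]

theorem between_unionBits {c : ℕ → RamseyCond C} (hc : ∀ m n, m ≤ n → (c n).Le (c m)) (b : Bool)
    (m : ℕ) : (c m).Between b (unionBits c b) := by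
  refine ⟨fun n hn => unionBits_eq_true.2 ⟨m, hn⟩, fun n hn => ?_⟩
  obtain ⟨k, hk⟩ := unionBits_eq_true.1 hn
  rcases le_total m k with h | h
  · exact (hc m k h).new b n hk
  · exact .inl ((hc k m h).subset b hk)

theorem homog_unionBits {c : ℕ → RamseyCond C} (hc : ∀ m n, m ≤ n → (c n).Le (c m))
    (hv : ∀ m, (c m).Valid 𝒮 L A j) (b : Bool) :
    Homog (C j) b {n | unionBits c b n = true} := by
  intro x hx y hy hxy
  obtain ⟨k, hk⟩ := unionBits_eq_true.1 hx
  obtain ⟨l, hl⟩ := unionBits_eq_true.1 hy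
  exact (hv (max k l)).homog b x ((hc k _ (le_max_left _ _)).subset b hk) y
    ((hc l _ (le_max_right _ _)).subset b hl) hxy

theorem RamseyCond.Avoids.exists_notMem {p : RamseyCond C} {b : Bool} {R : Set Orc} {s : Finset ι}
    {N : ℕ} (h : p.Avoids L A j b R s N) {G : Bits} (hG : p.Between b G)
    (hh : Homog (C j) b {n | G n = true}) : ∃ s' ⊆ s, Covers L N s' ∧
      ∀ i ∈ s', ∃ x, scons (patch A x (L i)) (scons G C) ∉ R := by
  obtain ⟨s', h1, h2, h3⟩ := h
  exact ⟨s', h1, h2, fun i hi => (h3 i hi).imp fun x hx => hx G hG hh⟩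

theorem exists_ramsey_of_subset [Countable ι] (h𝒮 : OpenFamily {m | IsMap L m} 𝒮)
    {p : RamseyCond C} (hp : p.Valid 𝒮 L A j) {b : Bool}
    (hb : ∀ n, p.X n = true → n ∈ limitClass (C j) b) :
    ∃ G : Bits, {n | G n = true}.Infinite ∧ Homog (C j) b {n | G n = true} ∧
      Keeps 𝒮 L A C (scons G C) := by
  have := h𝒮.countable.to_subtype
  let P := {q : RamseyCond C // q.Valid 𝒮 L A j ∧ ∀ n, q.X n = true → n ∈ limitClass (C j) b}
  obtain ⟨c, -, hc, hD⟩ := exists_generic_sequence (P := P) (I := (𝒮 × Finset ι × ℕ) ⊕ ℕ)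
    (r := fun q p => q.1.Le p.1)
    (D := fun i q => match i with
      | .inl (R, s, N) => Fair 𝒮 L A C s N → q.1.Met A b R ∨ q.1.Avoids L A j b R s N
      | .inr k => ∃ n ≥ k, n ∈ q.1.F b)
    (fun p => .refl p.1) (fun _ _ _ h h' => h.trans h')
    (by
      rintro (⟨R, s, N⟩ | k) ⟨p, hp, hpb⟩
      · by_cases hs : Fair 𝒮 L A C s N
        · obtain ⟨q, hq, hqp, h⟩ := hp.decides_of_subset h𝒮 hpb R.2 hs
          exact ⟨⟨q, hq, fun n hn => hpb n (hqp.reservoir n hn)⟩, hqp, fun _ => h⟩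
        · exact ⟨⟨p, hp, hpb⟩, .refl p, fun h => (hs h).elim⟩
      · obtain ⟨n, hn, hkn⟩ := (infinite_of_mem_hyperfilter hp.mem).exists_gt k
        obtain ⟨q, hq, hqp, h⟩ := hp.exists_mem h𝒮 hn (hpb n hn)
        exact ⟨⟨q, hq, fun n hn => hpb n (hqp.reservoir n hn)⟩, hqp, n, hkn.le, h⟩)
    ⟨p, hp, hb⟩
  let d : ℕ → RamseyCond C := fun n => (c n).1
  have hh : Homog (C j) b {n | unionBits d b n = true} := homog_unionBits hc (fun m => (c m).2.1) b
  refine ⟨unionBits d b, infinite_of_not_bddAbove ?_, hh, fun s N hs R hR hA => ?_⟩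
  · rintro ⟨k, hk⟩
    obtain ⟨m, n, hn, hmem⟩ := hD (.inr (k + 1))
    have := hk (unionBits_eq_true.2 ⟨m, hmem⟩ : n ∈ {n | unionBits d b n = true})
    omega
  · obtain ⟨m, h⟩ := hD (.inl (⟨R, hR⟩, s, N))
    rcases h hs with h | h
    · exact (hA (h _ (between_unionBits (c := d) hc b m))).elim
    · exact h.exists_notMem (between_unionBits (c := d) hc b m) hh

/-- Both sets are generic for one filter of conditions. Only the disjunction is controlled: which
color preserves fairness may depend on `s` and `N`. -/
theorem exists_ramsey_of_infinite [Countable ι] (h𝒮 : OpenFamily {m | IsMap L m} 𝒮)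
    (hcyl : ∀ σ k, offCylinder σ k ∈ 𝒮) {p : RamseyCond C} (hp : p.Valid 𝒮 L A j)
    (hinf : ∀ (q : RamseyCond C), q.Valid 𝒮 L A j → ∀ b,
      {n | q.X n = true ∧ n ∈ limitClass (C j) b}.Infinite) :
    ∃ G : Bool → Bits, (∀ b, {n | G b n = true}.Infinite ∧ Homog (C j) b {n | G b n = true}) ∧
      ∀ s (N : Bool → ℕ), Fair 𝒮 L A C s (N true + N false) →
        ∃ b, Fair 𝒮 L A (scons (G b) C) s (N b) := by
  have := h𝒮.countable.to_subtype
  let P := {q : RamseyCond C // q.Valid 𝒮 L A j}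
  obtain ⟨c, -, hc, hD⟩ := exists_generic_sequence (P := P)
    (I := ((Bool → 𝒮) × Finset ι × (Bool → ℕ)) ⊕ (Bool × ℕ))
    (r := fun q p => q.1.Le p.1)
    (D := fun i q => match i with
      | .inl (R, s, N) => Fair 𝒮 L A C s (N true + N false) →
          ∃ b, q.1.Met A b (R b) ∨ q.1.Avoids L A j b (R b) s (N b)
      | .inr (b, k) => ∃ n ≥ k, n ∈ q.1.F b)
    (fun p => .refl p.1) (fun _ _ _ h h' => h.trans h')
    (by
      rintro (⟨R, s, N⟩ | ⟨b, k⟩) ⟨p, hp⟩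
      · by_cases hs : Fair 𝒮 L A C s (N true + N false)
        · obtain ⟨q, hq, hqp, h⟩ := hp.decides h𝒮 hcyl (fun b => (R b).2) hs
          exact ⟨⟨q, hq⟩, hqp, fun _ => h⟩
        · exact ⟨⟨p, hp⟩, .refl p, fun h => (hs h).elim⟩
      · obtain ⟨n, hn, hkn⟩ := (hinf p hp b).exists_gt k
        obtain ⟨q, hq, hqp, h⟩ := hp.exists_mem h𝒮 hn.1 hn.2
        exact ⟨⟨q, hq⟩, hqp, n, hkn.le, h⟩)
    ⟨p, hp⟩
  let d : ℕ → RamseyCond C := fun n => (c n).1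
  have hh : ∀ b, Homog (C j) b {n | unionBits d b n = true} :=
    homog_unionBits hc fun m => (c m).2
  refine ⟨unionBits d, fun b => ⟨infinite_of_not_bddAbove ?_, hh b⟩, fun s N hs => ?_⟩
  · rintro ⟨k, hk⟩
    obtain ⟨m, n, hn, hmem⟩ := hD (.inr (b, k + 1))
    have := hk (unionBits_eq_true.2 ⟨m, hmem⟩ : n ∈ {n | unionBits d b n = true})
    omega
  · by_contra! hcon
    simp only [Fair, not_forall] at hcon
    choose R hR hA hno using hcon
    obtain ⟨m, h⟩ := hD (.inl (fun b => ⟨R b, hR b⟩, s, N))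
    obtain ⟨b, h | h⟩ := h hs
    · exact hA b (h _ (between_unionBits (c := d) hc b m))
    · exact hno b (h.exists_notMem (between_unionBits (c := d) hc b m) (hh b))

end RamseyTheorem

/-! ### Goodness and its preservation by Ramsey's theorem. -/

section Good

variable {κ : Type*} (𝒮 : Set (Set Orc)) (J : κ → Set ℕ) (A : Bits)

/-- The complement of the union of the sets `J q` with `q ∈ i`. -/
noncomputable def avoiding (i : Finset κ) : Bits :=
  open Classical in fun n => decide (∀ q ∈ i, n ∉ J q)

theorem avoiding_eq_true {i : Finset κ} {n : ℕ} : avoiding J i n = true ↔ ∀ q ∈ i, n ∉ J q := by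
  simp [avoiding]

/-- `C` is fair for sufficiently many finite sets of complements of unions of the sets `J q`: given
finitely many rows of at least `l` pairwise disjoint sets, we can find such complements each of
which omits a set from each row. -/
def Good (C : Orc) : Prop :=
  ∀ N, ∃ l, ∀ M : Finset (Finset κ),
    (∀ r ∈ M, l ≤ r.card ∧ (r : Set κ).PairwiseDisjoint J) →
      ∃ s : Finset (Finset κ), (∀ i ∈ s, ∀ r ∈ M, ∃ q ∈ r, q ∈ i) ∧ Fair 𝒮 (avoiding J) A C s N

variable {𝒮 J A}

theorem Good.keeps {C C' : Orc} (h : Good 𝒮 J A C) (hk : Keeps 𝒮 (avoiding J) A C C') :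
    Good 𝒮 J A C' := by
  intro N
  obtain ⟨l, hl⟩ := h N
  refine ⟨l, fun M hM => ?_⟩
  obtain ⟨s, hs, hF⟩ := hl M hM
  exact ⟨s, hs, hk _ _ hF⟩

theorem Good.exists_homog [Countable κ] {C : Orc} (hC : Good 𝒮 J A C)
    (h𝒮 : OpenFamily {m | IsMap (avoiding J) m} 𝒮) (hcyl : ∀ σ k, offCylinder σ k ∈ 𝒮) (j : ℕ) :
    ∃ G : Bits, ({n | G n = true}.Infinite ∧ ∃ b, Homog (C j) b {n | G n = true}) ∧
      Good 𝒮 J A (scons G C) := by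
  classical
  have h0 : (⟨fun _ => ∅, fun _ => true⟩ : RamseyCond C).Valid 𝒮 (avoiding J) A j :=
    ⟨by simp, h𝒮.keeps .full fun _ => rfl, fun b => by simp [Homog], by simp⟩
  by_cases hinf : ∀ q : RamseyCond C, q.Valid 𝒮 (avoiding J) A j → ∀ b,
      {n | q.X n = true ∧ n ∈ limitClass (C j) b}.Infinite
  · obtain ⟨G, hG, hF⟩ := exists_ramsey_of_infinite h𝒮 hcyl h0 hinf
    suffices ∃ b, Good 𝒮 J A (scons (G b) C) by
      obtain ⟨b, hb⟩ := this
      exact ⟨G b, ⟨(hG b).1, b, (hG b).2⟩, hb⟩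
    -- Counterexamples for the two colors are merged: the numbers are added and the families of rows
    -- are united. Fairness on either side then contradicts the counterexample for that color.
    by_contra! hcon
    simp only [Good, not_forall, not_exists, not_and] at hcon
    choose N hN using hcon
    obtain ⟨l, hl⟩ := hC (N true + N false)
    choose M hM hno using fun b => hN b l
    obtain ⟨s, hs, hsF⟩ := hl (M true ∪ M false) fun r hr =>
      (Finset.mem_union.1 hr).elim (hM true r) (hM false r)
    obtain ⟨b, hb⟩ := hF s N hsF
    refine hno b s (fun i hi r hr => hs i hi r ?_) hb
    cases b <;> simp [hr]
  · push Not at hinf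
    obtain ⟨q, hq, b, hfin⟩ := hinf
    obtain ⟨k, hk⟩ := hfin.bddAbove
    -- Beyond `k` the reservoir contains no number of limit color `b`, so the one-color construction
    -- applies.
    obtain ⟨q', hq', hqq', -, hX⟩ := hq.extend h𝒮 b (E := ∅) (by simp) (by simp)
      (by simpa using hq.homog b) (k + 1)
    obtain ⟨G, hG, hh, hkeep⟩ := exists_ramsey_of_subset h𝒮 hq' (b := !b) fun n hn =>
      (mem_limitClass_or (C j) b n).resolve_left fun h => by
        have h1 := hk ⟨hqq'.reservoir n hn, h⟩
        have h2 := hX n hn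
        omega
    exact ⟨G, ⟨hG, _, hh⟩, hC.keeps hkeep⟩

end Good

/-! ## A generic stable coloring -/

theorem npair_inj {x y x' y' : ℕ} (h : npair x y = npair x' y') : x = x' ∧ y = y' := by
  unfold npair at h
  have h1 : x + y = x' + y' := by
    rcases lt_trichotomy (x + y) (x' + y') with h' | h' | h'
    · nlinarith
    · exact h'
    · nlinarith
  rw [h1] at h
  omega

theorem le_npair (x y : ℕ) : y ≤ npair x y := by
  unfold npair
  have := Nat.le_mul_self (x + y)
  omega

/-- The set of the codes of the pairs `x < y` with `f x y = true`. -/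
noncomputable def colorBits (f : ℕ → ℕ → Bool) : Bits :=
  open Classical in fun t => decide (∃ x y, x < y ∧ t = npair x y ∧ f x y = true)

theorem colorBits_npair (f : ℕ → ℕ → Bool) {x y : ℕ} (h : x < y) :
    colorBits f (npair x y) = f x y := by
  have : (∃ x' y', x' < y' ∧ npair x y = npair x' y' ∧ f x' y' = true) ↔ f x y = true := by
    refine ⟨?_, fun hf => ⟨x, y, h, rfl, hf⟩⟩
    rintro ⟨x', y', -, he, hf⟩
    obtain ⟨rfl, rfl⟩ := npair_inj he
    exact hf
  simp [colorBits, this]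

theorem colorBits_congr {f f' : ℕ → ℕ → Bool} {k : ℕ}
    (h : ∀ x y, x < y → y < k → f x y = f' x y) {t : ℕ} (ht : t < k) :
    colorBits f t = colorBits f' t := by
  have : (∃ x y, x < y ∧ t = npair x y ∧ f x y = true) ↔
      ∃ x y, x < y ∧ t = npair x y ∧ f' x y = true := by
    refine exists₂_congr fun x y => and_congr_right fun hxy => and_congr_right fun hte => ?_
    have := le_npair x y
    rw [h x y hxy (by omega)]
  simp [colorBits, this]

/-- The sequence of sets that consists of a coloring and empty sets. -/
noncomputable def colorOrc (f : ℕ → ℕ → Bool) : Orc := scons (colorBits f) fun _ _ => false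

/-- A condition: a coloring and its limit colors up to `n`. -/
structure ColorCond where
  /-- the length -/
  n : ℕ
  /-- the coloring -/
  f : ℕ → ℕ → Bool
  /-- the limit colors -/
  A : Bits

/-- The coloring `f` with the limit colors `A` extends the condition. -/
structure ColorCond.Ext (p : ColorCond) (f : ℕ → ℕ → Bool) (A : Bits) : Prop where
  color : ∀ x y, x < y → y < p.n → f x y = p.f x y
  limit : ∀ x < p.n, A x = p.A x
  stable : ∀ x < p.n, ∀ y ≥ p.n, f x y = p.A x

theorem ColorCond.Ext.trans {p q : ColorCond} (hpq : p.Ext q.f q.A) (hn : p.n ≤ q.n)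
    {f : ℕ → ℕ → Bool} {A : Bits} (h : q.Ext f A) : p.Ext f A := by
  refine ⟨fun x y hxy hy => ?_, fun x hx => ?_, fun x hx y hy => ?_⟩
  · rw [h.color x y hxy (by omega), hpq.color x y hxy hy]
  · rw [h.limit x (by omega), hpq.limit x hx]
  · rcases lt_or_ge y q.n with hyq | hyq
    · rw [h.color x y (by omega) hyq, hpq.stable x hx y hy]
    · rw [h.stable x (by omega) y hyq, hpq.limit x hx]

/-- If some extension lies in `R`, a finite part of it is responsible. A condition fixes that part
and freezes the limit colors below its length, but leaves all later limit colors free. -/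
theorem ColorCond.exists_decides (p : ColorCond) (hp : p.Ext p.f p.A) {R : Set Orc}
    (hR : IsOpen R) : ∃ q : ColorCond, q.Ext q.f q.A ∧ p.n ≤ q.n ∧ p.Ext q.f q.A ∧
      ((∀ f A, q.Ext f A → scons A (colorOrc f) ∈ R) ∨
        ∀ f A, q.Ext f A → scons A (colorOrc f) ∉ R) := by
  by_cases h : ∃ f A, p.Ext f A ∧ scons A (colorOrc f) ∈ R
  · obtain ⟨f, A, hpf, hfR⟩ := h
    obtain ⟨k, hk⟩ := exists_bound_of_isOpen hR hfR
    let n := max p.n k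
    let f' : ℕ → ℕ → Bool := fun x y => if x < n ∧ n ≤ y then A x else f x y
    have hq : ColorCond.Ext ⟨n, f', A⟩ f' A :=
      ⟨fun _ _ _ _ => rfl, fun _ _ => rfl, fun x hx y hy => by
        change (if _ then _ else _) = _
        rw [if_pos ⟨hx, hy⟩]⟩
    refine ⟨⟨n, f', A⟩, hq, le_max_left _ _, ⟨fun x y hxy hy => ?_, hpf.limit, fun x hx y hy => ?_⟩,
      .inl fun f₁ A₁ h₁ => hk _ fun i _ m hm => ?_⟩
    · have : p.n ≤ n := le_max_left _ _
      have hny : ¬ n ≤ y := by omega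
      simpa [f', hny] using hpf.color x y hxy hy
    · by_cases hc : x < n ∧ n ≤ y
      · simpa [f', hc] using hpf.limit x hx
      · simpa [f', hc] using hpf.stable x hx y hy
    · have : k ≤ n := le_max_right _ _
      rcases i with _ | _ | i
      · exact h₁.limit m (lt_of_lt_of_le hm this)
      · refine colorBits_congr (fun x y hxy hy => ?_) hm
        have hny : ¬ n ≤ y := by omega
        simpa [f', hny] using h₁.color x y hxy (by simp; omega)
      · rfl
  · push Not at h
    exact ⟨p, hp, le_rfl, hp, .inr h⟩

/-- There is a generic stable coloring. -/
theorem exists_generic_coloring {𝒮 : Set (Set Orc)} (hc : 𝒮.Countable)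
    (ho : ∀ R ∈ 𝒮, IsOpen R) : ∃ (f : ℕ → ℕ → Bool) (A : Bits),
      (∀ x, ∃ n, ∀ y ≥ n, f x y = A x) ∧
      ∀ R ∈ 𝒮, scons A (colorOrc f) ∉ R → ∃ n, ∀ A' : Bits, (∀ x < n, A' x = A x) →
        scons A' (colorOrc f) ∉ R := by
  have := hc.to_subtype
  let P := {p : ColorCond // p.Ext p.f p.A}
  obtain ⟨c, -, hle, hD⟩ := exists_generic_sequence (P := P) (I := 𝒮 ⊕ ℕ)
    (r := fun q p => p.1.n ≤ q.1.n ∧ p.1.Ext q.1.f q.1.A)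
    (D := fun i q => match i with
      | .inl R => (∀ f A, q.1.Ext f A → scons A (colorOrc f) ∈ R.1) ∨
          ∀ f A, q.1.Ext f A → scons A (colorOrc f) ∉ R.1
      | .inr k => k ≤ q.1.n)
    (fun p => ⟨le_rfl, p.2⟩) (fun _ _ _ h h' => ⟨h'.1.trans h.1, h'.2.trans h'.1 h.2⟩)
    (by
      rintro (⟨R, hR⟩ | k) ⟨p, hp⟩
      · obtain ⟨q, hq, h1, h2, h3⟩ := p.exists_decides hp (ho R hR)
        exact ⟨⟨q, hq⟩, ⟨h1, h2⟩, h3⟩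
      · let n := max p.n k
        let f' : ℕ → ℕ → Bool := fun x y => if x < n ∧ n ≤ y then p.A x else p.f x y
        have hq : ColorCond.Ext ⟨n, f', p.A⟩ f' p.A :=
          ⟨fun _ _ _ _ => rfl, fun _ _ => rfl, fun x hx y hy => by
            change (if _ then _ else _) = _
            rw [if_pos ⟨hx, hy⟩]⟩
        refine ⟨⟨⟨n, f', p.A⟩, hq⟩, ⟨le_max_left _ _, ⟨fun x y hxy hy => ?_, fun _ _ => rfl,
          fun x hx y hy => ?_⟩⟩, le_max_right _ _⟩
        · have : p.n ≤ n := le_max_left _ _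
          have hny : ¬ n ≤ y := by dsimp only at hy; omega
          simp [f', hny]
        · by_cases hc : x < n ∧ n ≤ y
          · simp [f', hc]
          · simpa [f', hc] using hp.stable x hx y hy)
    ⟨⟨0, fun _ _ => true, fun _ => true⟩, by constructor <;> simp⟩
  choose m hm using fun k => hD (.inr k)
  dsimp only at hm
  -- Stage `m k` has length at least `k`, so it has settled all values below `k`.
  let f : ℕ → ℕ → Bool := fun x y => (c (m (max x y + 1))).1.f x y
  let A : Bits := fun x => (c (m (x + 1))).1.A x
  have hext : ∀ k, (c k).1.Ext f A := by
    intro k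
    refine ⟨fun x y hxy hy => ?_, fun x hx => ?_, fun x hx y hy => ?_⟩
    · have h := hm (max x y + 1)
      rcases le_total k (m (max x y + 1)) with h' | h'
      · exact (hle _ _ h').2.color x y hxy hy
      · exact ((hle _ _ h').2.color x y hxy (by omega)).symm
    · have h := hm (x + 1)
      rcases le_total k (m (x + 1)) with h' | h'
      · exact (hle _ _ h').2.limit x hx
      · exact ((hle _ _ h').2.limit x (by omega)).symm
    · have h := hm (max x y + 1)
      rcases le_total k (m (max x y + 1)) with h' | h'
      · exact (hle _ _ h').2.stable x hx y hy
      · have := (hle _ _ h').1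
        omega
  refine ⟨f, A, fun x => ?_, fun R hR hA => ?_⟩
  · have h := hm (x + 1)
    have he := hext (m (x + 1))
    exact ⟨_, fun y hy => (he.stable x (by omega) y hy).trans (he.limit x (by omega)).symm⟩
  · obtain ⟨k, h⟩ := hD (.inl ⟨R, hR⟩)
    rcases h with h | h
    · exact (hA (h f A (hext k))).elim
    · refine ⟨(c k).1.n, fun A' hA' => h f A' ⟨(hext k).color, fun x hx => ?_, (hext k).stable⟩⟩
      rw [hA' x hx, (hext k).limit x hx]

/-! ## The model -/

section Model

variable {κ : Type*} {𝒮 : Set (Set Orc)} {J : κ → Set ℕ} {A : Bits}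

/-- Of `N + 1` disjoint sets at least one misses any given `N` numbers. Hence the family of all
selections from the rows covers, and genericity admits every modification of `A` from some point on.
-/
theorem good_of_generic {C : Orc} (h : ∀ R ∈ 𝒮, scons A C ∉ R → ∃ n, ∀ A' : Bits,
    (∀ x < n, A' x = A x) → scons A' C ∉ R) : Good 𝒮 J A C := by
  classical
  refine fun N => ⟨N + 1, fun M hM => ?_⟩
  refine ⟨(M.biUnion id).powerset.filter fun i => ∀ r ∈ M, ∃ q ∈ r, q ∈ i, fun i hi => 
    (Finset.mem_filter.1 hi).2, fun R hR hA =>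
      ⟨_, Finset.Subset.rfl, fun Y hY => ?_, fun i _ => ?_⟩⟩
  -- All the sets that miss `Y` are omitted together; by the pigeonhole principle they include one
  -- from each row.
  · refine ⟨(M.biUnion id).filter fun q => ∀ y ∈ Y, y ∉ J q, Finset.mem_filter.2
      ⟨Finset.mem_powerset.2 (Finset.filter_subset _ _), fun r hr => ?_⟩, fun y hy =>
        (avoiding_eq_true J).2 fun q hq => (Finset.mem_filter.1 hq).2 y hy⟩
    by_contra! hcon
    have : ∀ q ∈ r, ∃ y ∈ Y, y ∈ J q := by
      intro q hq
      by_contra! hno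
      exact hcon q hq (Finset.mem_filter.2 ⟨Finset.mem_biUnion.2 ⟨r, hr, hq⟩, hno⟩)
    choose! g hg hgJ using this
    have hcard := Finset.card_le_card_of_injOn g hg fun q hq q' hq' he => by
      by_contra hne
      exact Set.disjoint_left.1 ((hM r hr).2 hq hq' hne) (hgJ q hq) (he ▸ hgJ q' hq')
    have := (hM r hr).1
    omega
  · obtain ⟨n, hn⟩ := h R hR hA
    exact ⟨n, hn _ fun x hx => by simp [patch, hx]⟩

/-- The new set `G` solves the problem `t` at `C`: to find a member of a nonempty closed class, or
an infinite homogeneous set. -/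
def Solves (C : Orc) (G : Bits) : 𝒮 ⊕ ℕ → Prop
  | .inl U => (∃ Y, scons Y C ∉ U.1) → scons G C ∉ U.1
  | .inr j => {n | G n = true}.Infinite ∧ ∃ b, Homog (C j) b {n | G n = true}

theorem Good.exists_solves [Countable κ] (h𝒮 : OpenFamily {m | IsMap (avoiding J) m} 𝒮)
    (hcyl : ∀ σ k, offCylinder σ k ∈ 𝒮) {C : Orc} (hC : Good 𝒮 J A C) (t : 𝒮 ⊕ ℕ) :
    ∃ G, Solves C G t ∧ Good 𝒮 J A (scons G C) := by
  rcases t with U | j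
  · by_cases hne : ∃ Y, scons Y C ∉ U.1
    · obtain ⟨Y, hY, hk⟩ := h𝒮.exists_keeps (A := A) hcyl U.2 hne
      exact ⟨Y, fun _ => hY, hC.keeps hk⟩
    · exact ⟨fun _ => true, fun h => (hne h).elim, hC.keeps (h𝒮.keeps .full fun _ => rfl)⟩
  · exact hC.exists_homog h𝒮 hcyl j

theorem exists_columns [Countable κ] (h𝒮 : OpenFamily {m | IsMap (avoiding J) m} 𝒮)
    (hcyl : ∀ σ k, offCylinder σ k ∈ 𝒮) {C₀ : Orc} (h₀ : Good 𝒮 J A C₀) :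
    ∃ (D : Orc) (C : ℕ → Orc), D 0 = C₀ 0 ∧ (∀ i, ∀ n ≤ i, C i n = D n) ∧
      (∀ i, Good 𝒮 J A (C i)) ∧ ∀ (t : 𝒮 ⊕ ℕ) (k : ℕ), ∃ i ≥ k, Solves (C i) (D (i + 1)) t := by
  have := h𝒮.countable.to_subtype
  obtain ⟨e, he⟩ := exists_surjective_nat (𝒮 ⊕ ℕ)
  choose g hg hgood using fun (c : {C : Orc // Good 𝒮 J A C}) => c.2.exists_solves h𝒮 hcyl
  let c : ℕ → {C : Orc // Good 𝒮 J A C} := fun n => Nat.rec ⟨C₀, h₀⟩ (fun i C =>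
    ⟨Function.update C.1 (i + 1) (g C (e i.unpair.1)),
      (hgood C _).keeps (h𝒮.keeps (.update (i + 1)) fun _ => rfl)⟩) n
  have hc : ∀ i, (c (i + 1)).1 =
      Function.update (c i).1 (i + 1) (g (c i) (e i.unpair.1)) := fun i => rfl
  have hcol : ∀ n i, n ≤ i → (c i).1 n = (c n).1 n := by
    intro n i hi
    induction i, hi using Nat.le_induction with
    | base => rfl
    | succ i hi ih => rw [hc, Function.update_of_ne (by omega), ih]
  refine ⟨fun n => (c n).1 n, fun i => (c i).1, rfl, fun i n h => hcol n i h, fun i => (c i).2, ?_⟩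
  intro t k
  obtain ⟨q, rfl⟩ := he t
  -- Stage `i` treats the problem numbered by the first component of `i`. Every problem thus recurs
  -- arbitrarily late, when its parameters are already columns.
  refine ⟨Nat.pair q k, Nat.right_le_pair _ _, ?_⟩
  have h := hg (c (Nat.pair q k)) (e q)
  dsimp only
  rw [hc, Function.update_self, Nat.unpair_pair]
  exact h

end Model

/-! ## Codes of binary strings -/

/-- `t` represents a binary string of length `l`. -/
def StrLen (t l : ℕ) : Prop := ∃ a b, t = npair l (npair a b)

/-- `t` represents a binary string with the entry `1` at the place `i`. -/
def StrOne (t i : ℕ) : Prop :=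
  ∃ l a b d, t = npair l (npair a b) ∧ i < l ∧ b = (1 + a * (i + 1)) * d

/-- The string represented by `s` is an initial segment of the string represented by `t`. -/
def StrPrefix (s t : ℕ) : Prop :=
  ∃ k l, StrLen s k ∧ StrLen t l ∧ k < l + 1 ∧ ∀ i < k, StrOne s i ↔ StrOne t i

/-- `t` is the code of a binary string. -/
def IsStr (t : ℕ) : Prop := (∃ l, StrLen t l) ∧ ∀ s < t, ¬ (StrPrefix s t ∧ StrPrefix t s)

section Sat
variable (M : Set Bits) (s t : Term) (e : ℕ → ℕ) (S : Orc)

@[simp] theorem eval_pair : (pair s t).eval e = npair (s.eval e) (t.eval e) := rfl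

@[simp] theorem sat_strLen : Sat M (strLen s t) e S ↔ StrLen (s.eval e) (t.eval e) := by
  simp [strLen, StrLen, Term.eval_up]

@[simp] theorem sat_strOne : Sat M (strOne s t) e S ↔ StrOne (s.eval e) (t.eval e) := by
  simp [strOne, StrOne, Term.eval_up]

@[simp] theorem sat_strPrefix : Sat M (strPrefix s t) e S ↔ StrPrefix (s.eval e) (t.eval e) := by
  simp [strPrefix, StrPrefix, Term.eval_up]

@[simp] theorem sat_isStr : Sat M (isStr t) e S ↔ IsStr (t.eval e) := by
  simp [isStr, IsStr, Term.eval_up]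

@[simp] theorem sat_infinite (X : ℕ) :
    Sat M (infinite X) e S ↔ {n | S X n = true}.Infinite := by
  simp [infinite, Set.infinite_iff_exists_gt, and_comm]

theorem sat_isTree (X : ℕ) : Sat M (isTree X) e S ↔ (∀ n, S X n = true → IsStr n) ∧
    ∀ m n, IsStr m ∧ S X n = true ∧ StrPrefix m n → S X m = true := by
  simp [isTree]

theorem sat_isPath (P X : ℕ) : Sat M (isPath P X) e S ↔ ∀ l, ∃ t, S X t = true ∧ StrLen t l ∧
    ∀ i < l, (StrOne t i ↔ S P i = true) := by
  simp [isPath]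

theorem sat_hasColor (F : ℕ) (b : Bool) : Sat M (hasColor F (if b then 1 else 0) s t) e S ↔
    S F (npair (s.eval e) (t.eval e)) = b := by
  cases b <;> simp [hasColor]

theorem sat_homogeneous (F H : ℕ) (b : Bool) :
    Sat M (homogeneous F H (if b then 1 else 0)) e S ↔ Homog (S F) b {n | S H n = true} := by
  simp only [homogeneous, sat_allN, sat_imp, sat_hasColor, Homog]
  simp only [sat_conj, sat_mem, sat_lt, eval_var, scons_zero, scons_succ]
  exact ⟨fun h x hx y hy hxy => h x y ⟨hx, hy, hxy⟩,
    fun h x y hxy => h x hxy.1 y hxy.2.1 hxy.2.2⟩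

end Sat

theorem StrLen.unique {t l l' : ℕ} (h : StrLen t l) (h' : StrLen t l') : l = l' := by
  obtain ⟨a, b, rfl⟩ := h
  obtain ⟨a', b', h⟩ := h'
  exact (npair_inj h).1

theorem strOne_npair {l a b i : ℕ} (hi : i < l) :
    StrOne (npair l (npair a b)) i ↔ 1 + a * (i + 1) ∣ b := by
  refine ⟨?_, fun ⟨d, hd⟩ => ⟨l, a, b, d, rfl, hi, hd⟩⟩
  rintro ⟨l', a', b', d, h, -, hd⟩
  obtain ⟨rfl, rfl⟩ := npair_inj (npair_inj h).2
  exact ⟨d, hd⟩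

/-- `t` represents the first `l` entries of `σ`. -/
def Represents (t l : ℕ) (σ : Bits) : Prop := StrLen t l ∧ ∀ i < l, (StrOne t i ↔ σ i = true)

theorem Represents.congr {t l : ℕ} {σ τ : Bits} (h : ∀ i < l, σ i = τ i) :
    Represents t l σ ↔ Represents t l τ :=
  and_congr_right fun _ => forall₂_congr fun i hi => by rw [h i hi]

theorem Represents.strPrefix {s t k l : ℕ} {σ : Bits} (hs : Represents s k σ)
    (ht : Represents t l σ) (hkl : k ≤ l) : StrPrefix s t :=
  ⟨k, l, hs.1, ht.1, by omega, fun i hi => (hs.2 i hi).trans (ht.2 i (by omega)).symm⟩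

/-- With `a = l!` the moduli `1 + a (i + 1)` for `i < l` are pairwise coprime, so the product of
those with `σ i = true` is divisible by no other one. -/
theorem exists_represents (l : ℕ) (σ : Bits) : ∃ t, Represents t l σ := by
  let m : ℕ → ℕ := fun i => 1 + l.factorial * (i + 1)
  have hm : ∀ i < l, ∀ j < l, i ≠ j → Nat.Coprime (m i) (m j) := by
    have key : ∀ i j, i < j → j < l → Nat.Coprime (m i) (m j) := fun i j hij hj => by
      simpa [m, add_comm, mul_comm] using Nat.coprime_mul_succ (n := i + 1) (m := j + 1)
        (Nat.dvd_factorial (n := l) (by omega) (by omega))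
    intro i hi j hj hij
    rcases lt_or_gt_of_ne hij with h | h
    exacts [key i j h hj, (key j i h hi).symm]
  refine ⟨npair l (npair l.factorial (∏ i ∈ (Finset.range l).filter (σ · = true), m i)),
    ⟨_, _, rfl⟩, fun i hi => ?_⟩
  rw [strOne_npair hi]
  refine ⟨fun h => ?_, fun h => Finset.dvd_prod_of_mem m (by simp [hi, h])⟩
  by_contra hσ
  have hco : Nat.Coprime (m i) (∏ i ∈ (Finset.range l).filter (σ · = true), m i) := by
    refine Nat.Coprime.prod_right fun j hj => ?_
    simp only [Finset.mem_filter, Finset.mem_range] at hj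
    exact hm i hi j hj.1 fun h => hσ (h ▸ hj.2)
  have h1 : m i = 1 := Nat.Coprime.eq_one_of_dvd hco h
  have := Nat.factorial_pos l
  have : 0 < l.factorial * (i + 1) := by positivity
  simp only [m] at h1
  omega

open Classical in
/-- The code of the first `l` entries of `σ`. -/
noncomputable def strCode (l : ℕ) (σ : Bits) : ℕ := Nat.find (exists_represents l σ)

theorem represents_strCode (l : ℕ) (σ : Bits) : Represents (strCode l σ) l σ := by
  classical exact Nat.find_spec (exists_represents l σ)

theorem strCode_congr {l : ℕ} {σ τ : Bits} (h : ∀ i < l, σ i = τ i) :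
    strCode l σ = strCode l τ := by
  unfold strCode
  congr 1
  ext t
  exact Represents.congr h

theorem isStr_strCode (l : ℕ) (σ : Bits) : IsStr (strCode l σ) := by
  classical
  have h := represents_strCode l σ
  refine ⟨⟨l, h.1⟩, fun s hs hp => Nat.find_min (exists_represents l σ) hs ?_⟩
  obtain ⟨⟨k, l', h1, h2, h3, h4⟩, ⟨k', l'', h5, h6, h7, -⟩⟩ := hp
  obtain rfl := h2.unique h.1
  obtain rfl := h5.unique h.1
  obtain rfl := h6.unique h1
  obtain rfl : l'' = k' := by omega
  exact ⟨h1, fun i hi => (h4 i hi).trans (h.2 i hi)⟩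

theorem IsStr.exists_eq {t : ℕ} (h : IsStr t) : ∃ l σ, t = strCode l σ := by
  classical
  obtain ⟨⟨l, hl⟩, hmin⟩ := h
  have ht : Represents t l fun i => decide (StrOne t i) := ⟨hl, by simp⟩
  refine ⟨l, _, le_antisymm ?_ (Nat.find_min' (exists_represents l _) ht)⟩
  by_contra! hlt
  have hs := represents_strCode l fun i => decide (StrOne t i)
  exact hmin _ hlt ⟨hs.strPrefix ht le_rfl, ht.strPrefix hs le_rfl⟩

theorem finite_strCode (l : ℕ) : {t | ∃ k < l, ∃ σ, t = strCode k σ}.Finite := by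
  refine ((Finset.range l ×ˢ (Finset.range l).powerset).image
    fun p => strCode p.1 (finBits p.2)).finite_toSet.subset ?_
  rintro t ⟨k, hk, σ, rfl⟩
  simp only [Finset.coe_image, mem_image, Finset.mem_coe, Finset.mem_product, Finset.mem_range,
    Finset.mem_powerset, Prod.exists]
  refine ⟨k, (Finset.range l).filter (σ · = true), ⟨hk, Finset.filter_subset _ _⟩,
    strCode_congr fun i hi => ?_⟩
  simp [finBits, show i < l by omega]

/-- The sequences such that some initial segment of `Z₀` is not in the tree `Zⱼ₊₁`. -/
def offTree (j : ℕ) : Set Orc := {Z | ∃ l, Z (j + 1) (strCode l (Z 0)) = false}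

/-- The code depends only on the first `l` bits, for which there are finitely many possibilities. -/
theorem isClopen_strCode_mem (j l : ℕ) (b : Bool) :
    IsClopen {Z : Orc | Z (j + 1) (strCode l (Z 0)) = b} := by
  have : {Z : Orc | Z (j + 1) (strCode l (Z 0)) = b} = ⋃ F ∈ (Finset.range l).powerset,
      {Z : Orc | ∀ i ∈ Finset.range l, Z 0 i = finBits F i} ∩
        {Z : Orc | Z (j + 1) (strCode l (finBits F)) = b} := by
    ext Z
    simp only [mem_ofPred_eq, mem_iUnion, mem_inter_iff, exists_prop]
    constructor
    · intro h
      have hF : ∀ i ∈ Finset.range l, Z 0 i =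
          finBits ((Finset.range l).filter (Z 0 · = true)) i := by
        intro i hi
        simp [finBits, Finset.mem_range.1 hi]
      refine ⟨_, Finset.mem_powerset.2 (Finset.filter_subset _ _), hF, ?_⟩
      rwa [← strCode_congr fun i hi => hF i (Finset.mem_range.2 hi)]
    · rintro ⟨F, -, h1, h2⟩
      rwa [strCode_congr fun i hi => h1 i (Finset.mem_range.2 hi)]
  rw [this]
  exact isClopen_biUnion_finset fun F _ =>
    (isClopen_finset_forall _ fun i _ => isClopen_bit 0 i _).inter (isClopen_bit _ _ _)

theorem isOpen_offTree (j : ℕ) : IsOpen (offTree j) := by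
  have : offTree j = ⋃ l, {Z : Orc | Z (j + 1) (strCode l (Z 0)) = false} := by
    ext; simp [offTree]
  rw [this]
  exact isOpen_iUnion fun l => (isClopen_strCode_mem j l false).isOpen

/-- Every infinite tree has a path. -/
theorem exists_path {C : Orc} {j : ℕ} (hinf : {n | C j n = true}.Infinite)
    (hstr : ∀ n, C j n = true → IsStr n)
    (hpre : ∀ m n, IsStr m ∧ C j n = true ∧ StrPrefix m n → C j m = true) :
    ∃ Y, scons Y C ∉ offTree j := by
  let K : ℕ → Set Bits := fun l => {Y | C j (strCode l Y) = true}
  have hK : ∀ l, IsClosed (K l) := fun l =>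
    (isClopen_strCode_mem j l true).isClosed.preimage
      (f := fun Y : Bits => scons Y C) (by fun_prop)
  have hanti : ∀ k l, k ≤ l → K l ⊆ K k := fun k l hkl Y hY =>
    hpre _ _ ⟨isStr_strCode k Y, hY,
      (represents_strCode k Y).strPrefix (represents_strCode l Y) hkl⟩
  have hne : ∀ l, (K l).Nonempty := by
    intro l
    obtain ⟨t, ht, hl⟩ := (hinf.sdiff (finite_strCode l)).nonempty
    obtain ⟨k, σ, rfl⟩ := (hstr t ht).exists_eq
    have hlk : l ≤ k := by
      by_contra! h
      exact hl ⟨k, h, σ, rfl⟩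
    exact ⟨σ, hanti l k hlk ht⟩
  obtain ⟨Y, hY⟩ := IsCompact.nonempty_iInter_of_sequence_nonempty_isCompact_isClosed K
    (fun l => hanti _ _ l.le_succ) hne (hK 0).isCompact hK
  refine ⟨Y, ?_⟩
  rintro ⟨l, hl⟩
  have : C j (strCode l Y) = true := mem_iInter.1 hY l
  simp_all

/-! ## Codes of rationals -/

/-- The code of `(a - b) / c`. -/
def fracCode (p : ℕ × ℕ × ℕ) : ℕ := npair (npair p.1 p.2.1) p.2.2

theorem fracCode_injective : Function.Injective fracCode := by
  rintro ⟨a, b, c⟩ ⟨a', b', c'⟩ h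
  obtain ⟨h, rfl⟩ := npair_inj h
  obtain ⟨rfl, rfl⟩ := npair_inj h
  rfl

/-- The rational number with a given code. -/
noncomputable def ratVal : ℕ → ℚ :=
  Function.extend fracCode (fun p => ((p.1 : ℚ) - p.2.1) / p.2.2) 0

theorem ratVal_npair (a b c : ℕ) : ratVal (npair (npair a b) c) = ((a : ℚ) - b) / c :=
  fracCode_injective.extend_apply _ _ (a, b, c)

/-- `t` is the code of a rational number. -/
def IsRat (t : ℕ) : Prop := ∃ a b c, t = npair (npair a b) c ∧ (a = 0 ∨ b = 0) ∧ 0 < c ∧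
  ∀ d u v, d * u = a + b ∧ d * v = c → d = 1

section Sat
variable (M : Set Bits) (s t : Term) (e : ℕ → ℕ) (S : Orc)

@[simp] theorem sat_isRat : Sat M (isRat t) e S ↔ IsRat (t.eval e) := by
  simp [isRat, IsRat, Term.eval_up]

theorem sat_ltRat (hs : IsRat (s.eval e)) (ht : IsRat (t.eval e)) :
    Sat M (ltRat s t) e S ↔ ratVal (s.eval e) < ratVal (t.eval e) := by
  obtain ⟨a, b, c, hs, -, hc, -⟩ := hs
  obtain ⟨a', b', c', ht, -, hc', -⟩ := ht
  have key : a * c' + b' * c < a' * c + b * c' ↔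
      ratVal (npair (npair a b) c) < ratVal (npair (npair a' b') c') := by
    rw [ratVal_npair, ratVal_npair, div_lt_div_iff₀ (by exact_mod_cast hc) (by exact_mod_cast hc'),
      ← Nat.cast_lt (α := ℚ)]
    push_cast
    constructor <;> intro h <;> linarith
  rw [hs, ht, ← key]
  simp only [ltRat, sat_exN, sat_conj, sat_eq, sat_lt, Term.eval_up, eval_pair, eval_var,
    scons_zero, scons_succ, eval_add, eval_mul, hs, ht]
  refine ⟨?_, fun h => ⟨a, b, c, a', b', c', rfl, rfl, h⟩⟩
  rintro ⟨a₁, b₁, c₁, a₂, b₂, c₂, h₁, h₂, h⟩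
  cases fracCode_injective (a₁ := (a, b, c)) (a₂ := (a₁, b₁, c₁)) h₁
  cases fracCode_injective (a₁ := (a', b', c')) (a₂ := (a₂, b₂, c₂)) h₂
  exact h

theorem sat_ratSubset (X : ℕ) : Sat M (ratSubset X) e S ↔ ∀ n, S X n = true → IsRat n := by
  simp [ratSubset]

end Sat

/-- The rationals strictly between two rationals. -/
def ratIoo (q : ℚ × ℚ) : Set ℕ := {t | q.1 < ratVal t ∧ ratVal t < q.2}

theorem isRat_nat_add_inv (i k : ℕ) : IsRat (npair (npair (i * (k + 1) + 1) 0) (k + 1)) := by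
  refine ⟨_, _, _, rfl, .inr rfl, by omega, fun d u v h => Nat.dvd_one.1 ?_⟩
  have h1 : d ∣ k + 1 := ⟨v, h.2.symm⟩
  exact (Nat.dvd_add_right (h1.mul_left i)).1 ⟨u, h.1.symm⟩

theorem ratVal_nat_add_inv (i k : ℕ) :
    ratVal (npair (npair (i * (k + 1) + 1) 0) (k + 1)) = i + 1 / (k + 1) := by
  rw [ratVal_npair]
  push_cast
  field_simp
  ring

/-- A set of order type `ω` is infinite. -/
theorem infinite_of_orderTypeOmega {M : Set Bits} {X : ℕ} {e : ℕ → ℕ} {S : Orc}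
    (hX : ∀ n, S X n = true → IsRat n) (h : Sat M (orderTypeOmega X) e S) :
    {n | S X n = true}.Infinite := by
  simp only [orderTypeOmega, orderIso, sat_exS, sat_conj, sat_allN, sat_imp, sat_exN, sat_mem,
    sat_iff, eval_pair, eval_var, scons_zero, scons_succ, sat_eq, sat_lt, true_imp_iff,
    true_and] at h
  obtain ⟨G, -, h1, -, h3⟩ := h
  choose g hgX hgG using h1
  refine infinite_of_injective_forall_mem (f := g)
    (.of_lt_imp_ne fun x x' hlt hxx => ?_) hgX
  have := h3 x x' (g x) (g x') ⟨hgX x, hgX x', hgG x, hgG x'⟩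
  rw [sat_ltRat] at this
  · exact absurd (this.1 hlt) (by simp [hxx])
  · exact hX _ (hgX x)
  · exact hX _ (hgX x')

/-- A set of order type `η` is infinite on each of arbitrarily many disjoint intervals. -/
theorem exists_intervals_of_orderTypeEta {M : Set Bits} {X : ℕ} {e : ℕ → ℕ} {S : Orc}
    (hX : ∀ n, S X n = true → IsRat n) (h : Sat M (orderTypeEta X) e S) (l : ℕ) :
    ∃ r : Finset (ℚ × ℚ), l ≤ r.card ∧ (r : Set (ℚ × ℚ)).PairwiseDisjoint ratIoo ∧
      ∀ q ∈ r, ({n | S X n = true} ∩ ratIoo q).Infinite := by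
  simp only [orderTypeEta, orderIso, sat_exS, sat_conj, sat_allN, sat_imp, sat_exN, sat_mem,
    sat_iff, eval_pair, eval_var, scons_zero, scons_succ, sat_isRat] at h
  obtain ⟨G, -, h1, -, h3⟩ := h
  choose! g hgX hgG using h1
  have hlt : ∀ x x', IsRat x → IsRat x' →
      (ratVal x < ratVal x' ↔ ratVal (g x) < ratVal (g x')) := by
    intro x x' hx hx'
    have := h3 x x' (g x) (g x') ⟨hx, hx', hgX x hx, hgX x' hx', hgG x hx, hgG x' hx'⟩
    rwa [sat_ltRat, sat_ltRat] at this
    exacts [hX _ (hgX x hx), hX _ (hgX x' hx'), hx, hx']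
  -- This is the code of `i + 1 / (k + 1)` in lowest terms. The images of the integers `u i 0` bound
  -- the intervals; the images of `u (i + 1) (k + 1)` lie inside the interval with index `i`.
  let u : ℕ → ℕ → ℕ := fun i k => npair (npair (i * (k + 1) + 1) 0) (k + 1)
  have hu : ∀ i k, IsRat (u i k) := isRat_nat_add_inv
  let v : ℕ → ℚ := fun i => ratVal (g (u i 0))
  have hv : StrictMono v := strictMono_nat_of_lt_succ fun i => (hlt _ _ (hu _ _) (hu _ _)).1 (by
    simp only [u, ratVal_nat_add_inv]
    push_cast
    linarith)
  refine ⟨(Finset.range l).image fun i => (v i, v (i + 1)), ?_, ?_, ?_⟩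
  · rw [Finset.card_image_of_injective, Finset.card_range]
    exact fun i j hij => hv.injective (Prod.ext_iff.1 hij).1
  · rw [Finset.coe_image]
    rintro _ ⟨i, -, rfl⟩ _ ⟨j, -, rfl⟩ hne
    refine Set.disjoint_left.2 fun t hi hj => ?_
    have hij : i ≠ j := fun h => hne (by rw [h])
    rcases lt_or_gt_of_ne hij with h | h
    · exact absurd (hv.monotone (Nat.succ_le_of_lt h)) (not_le.2 (hj.1.trans hi.2))
    · exact absurd (hv.monotone (Nat.succ_le_of_lt h)) (not_le.2 (hi.1.trans hj.2))
  · intro q hq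
    obtain ⟨i, -, rfl⟩ := Finset.mem_image.1 hq
    have hanti : StrictAnti fun k => ratVal (g (u (i + 1) (k + 1))) :=
      strictAnti_nat_of_succ_lt fun k => (hlt _ _ (hu _ _) (hu _ _)).1 (by
        simp only [u, ratVal_nat_add_inv]
        push_cast
        gcongr
        linarith)
    have hpos : ∀ k : ℕ, (0 : ℚ) < 1 / (k + 1 + 1) := fun k => by positivity
    have hlt1 : ∀ k : ℕ, (1 : ℚ) / (k + 1 + 1) < 1 := fun k => by
      rw [div_lt_one (by positivity)]
      linarith [(k.cast_nonneg : (0 : ℚ) ≤ k)]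
    refine infinite_of_injective_forall_mem (f := fun k => g (u (i + 1) (k + 1)))
      (Function.Injective.of_comp hanti.injective) fun k => ⟨hgX _ (hu _ _), ?_, ?_⟩
    · refine (hlt _ _ (hu _ _) (hu _ _)).1 ?_
      simp only [u, ratVal_nat_add_inv]
      push_cast
      linarith [hpos k]
    · refine (hlt _ _ (hu _ _) (hu _ _)).1 ?_
      simp only [u, ratVal_nat_add_inv]
      push_cast
      linarith [hlt1 k]

/-! ## The basic open sets -/

/-- The complement of the class of the sets `Z₀` that separate `{n | ∃ m θ}` from
`{n | ∃ m ¬ θ'}`. -/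
def offSep (θ θ' : Formula) (e ρ : ℕ → ℕ) : Set Orc :=
  {Z | ∃ n m, (Sat ∅ θ (scons m (scons n e)) (fun i => Z (ρ i + 1)) ∧ Z 0 n = false) ∨
    (¬ Sat ∅ θ' (scons m (scons n e)) (fun i => Z (ρ i + 1)) ∧ Z 0 n = true)}

theorem isOpen_offSep {θ θ' : Formula} (hθ : IsDelta0 θ) (hθ' : IsDelta0 θ') (e ρ : ℕ → ℕ) :
    IsOpen (offSep θ θ' e ρ) := by
  simp only [offSep, ofPred_exists, ofPred_or, ofPred_and]
  have hc : Continuous fun (Z : Orc) i => Z (ρ i + 1) := by fun_prop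
  refine isOpen_iUnion fun n => isOpen_iUnion fun m => IsOpen.union
    (IsOpen.inter ?_ (isClopen_bit 0 n false).isOpen)
    (IsOpen.inter ?_ (isClopen_bit 0 n true).isOpen)
  · exact (hθ.isClopen ∅ _).isOpen.preimage hc
  · exact (hθ'.isClopen ∅ _).compl.isOpen.preimage hc

/-- The sequences such that some element of `Zⱼ₊₁` has the value `b` in `Z₀`. -/
def hitSet (j : ℕ) (b : Bool) : Set Orc := {Z | ∃ n, Z (j + 1) n = true ∧ Z 0 n = b}

theorem isOpen_hitSet (j : ℕ) (b : Bool) : IsOpen (hitSet j b) := by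
  simp only [hitSet, ofPred_exists, ofPred_and]
  exact isOpen_iUnion fun n => (isClopen_bit _ n _).isOpen.inter (isClopen_bit _ n _).isOpen

theorem isOpen_offCylinder (σ : Bits) (k : ℕ) : IsOpen (offCylinder σ k) := by
  have : offCylinder σ k = ⋃ n, ⋃ (_ : n < k), {Z : Orc | Z 0 n = σ n}ᶜ := by
    ext; simp [offCylinder]
  rw [this]
  exact isOpen_iUnion fun n => isOpen_iUnion fun _ => (isClopen_bit 0 n _).compl.isOpen

/-- The sequence that continues a list by zeros. -/
def listSeq (l : List ℕ) : ℕ → ℕ := fun n => l.getD n 0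

theorem listSeq_map_range (e : ℕ → ℕ) (k : ℕ) :
    listSeq ((List.range k).map e) = fun n => if n < k then e n else 0 := by
  funext n
  by_cases h : n < k <;> simp [listSeq, h]

/-- The open sets that have to be treated in the construction of the model. -/
inductive IsBasic : Set Orc → Prop
  | offCylinder (σ : Bits) (k : ℕ) : IsBasic (offCylinder σ k)
  | offSep {θ θ' : Formula} (hθ : IsDelta0 θ) (hθ' : IsDelta0 θ') (l l' : List ℕ) :
      IsBasic (offSep θ θ' (listSeq l) (listSeq l'))
  | offTree (j : ℕ) : IsBasic (offTree j)
  | hitSet (j : ℕ) (b : Bool) : IsBasic (hitSet j b)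

theorem IsBasic.isOpen {R : Set Orc} (h : IsBasic R) : IsOpen R := by
  cases h with
  | offCylinder => exact isOpen_offCylinder _ _
  | offSep hθ hθ' => exact isOpen_offSep hθ hθ' _ _
  | offTree => exact isOpen_offTree _
  | hitSet => exact isOpen_hitSet _ _

theorem countable_isBasic : {R | IsBasic R}.Countable := by
  refine Countable.mono ?_ (((countable_range fun p : Finset ℕ × ℕ =>
    offCylinder (finBits p.1) p.2).union (countable_range
      fun p : Formula × Formula × List ℕ × List ℕ =>
        offSep p.1 p.2.1 (listSeq p.2.2.1) (listSeq p.2.2.2))).union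
    ((countable_range offTree).union (countable_range fun p : ℕ × Bool => hitSet p.1 p.2)))
  rintro R (⟨σ, k⟩ | ⟨-, -, l, l'⟩ | j | ⟨j, b⟩)
  · refine .inl (.inl ⟨((Finset.range k).filter (σ · = true), k), ?_⟩)
    ext Z
    refine exists_congr fun n => and_congr_right fun hn => ?_
    simp [finBits, hn]
  · exact .inl (.inr ⟨(_, _, l, l'), rfl⟩)
  · exact .inr (.inl ⟨j, rfl⟩)
  · exact .inr (.inr ⟨(j, b), rfl⟩)

/-! ## The axioms -/

section Axioms

variable {D : Orc} {C : ℕ → Orc}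

theorem sat_basicAxiom {φ : Formula} (h : BasicAxiom φ) (M : Set Bits) (e : ℕ → ℕ) (S : Orc) :
    Sat M φ e S := by
  cases h <;> simp <;> first | omega | ring

theorem sat_inductionAxiom (φ : Formula) (M : Set Bits) (e : ℕ → ℕ) (S : Orc) :
    Sat M (inductionAxiom φ) e S := by
  simp only [inductionAxiom, sat_imp, sat_conj, sat_instN, sat_allN, sat_subst, id]
  rintro ⟨h0, h1⟩ n
  induction n with
  | zero => exact h0
  | succ n ih =>
    convert h1 n ih using 1
    funext i
    cases i <;> rfl

/-- When the two formulas are equivalent, the class of separating sets has exactly one member, the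
desired set. Finding members of closed classes thus yields comprehension. -/
theorem sat_comprehensionAxiom (hC : ∀ i, ∀ n ≤ i, C i n = D n)
    (hD : ∀ R, IsBasic R → ∀ k, ∃ i ≥ k, (∃ Y, scons Y (C i) ∉ R) → scons (D (i + 1)) (C i) ∉ R)
    {φ ψ : Formula} (hφ : IsSigma1 φ) (hψ : IsPi1 ψ) (e : ℕ → ℕ) {S : Orc}
    (hS : ∀ j, S j ∈ range D) : Sat (range D) (comprehensionAxiom φ ψ) e S := by
  classical
  obtain ⟨θ, hθ, rfl⟩ := hφ
  obtain ⟨θ', hθ', rfl⟩ := hψ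
  choose ρ hρ using hS
  obtain ⟨k, hk⟩ := exists_bound (range D) θ
  obtain ⟨k', hk'⟩ := exists_bound (range D) θ'
  let K := max k k'
  -- The basic sets are indexed by finite lists to keep them countable; only the first `K` variables
  -- matter.
  let e' := listSeq ((List.range K).map e)
  let ρ' := listSeq ((List.range K).map ρ)
  have he : ∀ m n, ∀ i < K, scons m (scons n e) i = scons m (scons n e') i := fun m n =>
    scons_congr (scons_congr fun i hi => by simp [e', listSeq_map_range, hi])
  -- The stage is late enough that all set parameters are already columns of `C i`.
  obtain ⟨i, hi, hi'⟩ := hD _ (.offSep hθ hθ' ((List.range K).map e) ((List.range K).map ρ))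
    ((Finset.range K).sup ρ)
  have hSρ : ∀ n < K, S n = C i (ρ' n) := fun n hn => by
    have hle : ρ n ≤ i := le_trans (Finset.le_sup (Finset.mem_range.2 hn)) hi
    simp only [ρ', listSeq_map_range, hn, if_true, hC i _ hle, hρ]
  have h1 : ∀ m n, Sat (range D) θ (scons m (scons n e)) S ↔
      Sat ∅ θ (scons m (scons n e')) fun n => C i (ρ' n) := fun m n =>
    (hk _ _ _ _ (fun j hj => he m n j (lt_of_lt_of_le hj (le_max_left _ _)))
      fun j hj => hSρ j (lt_of_lt_of_le hj (le_max_left _ _))).trans (hθ.sat_iff_sat ..)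
  have h2 : ∀ m n, Sat (range D) θ' (scons m (scons n e)) S ↔
      Sat ∅ θ' (scons m (scons n e')) fun n => C i (ρ' n) := fun m n =>
    (hk' _ _ _ _ (fun j hj => he m n j (lt_of_lt_of_le hj (le_max_right _ _)))
      fun j hj => hSρ j (lt_of_lt_of_le hj (le_max_right _ _))).trans (hθ'.sat_iff_sat ..)
  simp only [comprehensionAxiom, sat_imp, sat_allN, sat_iff, sat_exN, sat_exS, sat_mem, sat_shiftS,
    eval_var, scons_zero, h1, h2]
  intro h
  refine ⟨_, mem_range_self (i + 1), fun n => ?_⟩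
  have hsep := hi' ⟨fun n => decide (∃ m, Sat ∅ θ (scons m (scons n e')) fun n => C i (ρ' n)), ?_⟩
  · have hn := fun m => not_or.1 fun hc => hsep ⟨n, m, hc⟩
    refine ⟨fun hG => (h n).2 fun m => ?_, fun ⟨m, hm⟩ => ?_⟩
    · by_contra hno
      exact (hn m).2 ⟨hno, hG⟩
    · by_contra hno
      exact (hn m).1 ⟨hm, by simpa using hno⟩
  · rintro ⟨n, m, ⟨hm, hn⟩ | ⟨hm, hn⟩⟩
    · simp only [scons_zero, decide_eq_false_iff_not] at hn
      exact hn ⟨m, hm⟩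
    · simp only [scons_zero, decide_eq_true_eq] at hn
      exact hm ((h n).1 hn m)

theorem sat_WKL (hC : ∀ i, ∀ n ≤ i, C i n = D n)
    (hD : ∀ R, IsBasic R → ∀ k, ∃ i ≥ k, (∃ Y, scons Y (C i) ∉ R) → scons (D (i + 1)) (C i) ∉ R)
    (e : ℕ → ℕ) (S : Orc) : Sat (range D) WKL e S := by
  simp only [WKL, sat_allS, sat_imp, sat_conj, sat_exS, sat_isPath, sat_isTree, sat_infinite,
    scons_zero, scons_succ]
  rintro _ ⟨j, rfl⟩ ⟨⟨h1, h2⟩, h3⟩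
  obtain ⟨i, hi, hi'⟩ := hD _ (.offTree j) j
  rw [← hC i j hi] at h1 h2 h3 ⊢
  have hpath := hi' (exists_path h3 h1 h2)
  refine ⟨_, mem_range_self (i + 1), fun l => ⟨strCode l (D (i + 1)), ?_, represents_strCode l _⟩⟩
  by_contra hno
  exact hpath ⟨l, by simpa using hno⟩

theorem sat_RT22 (hC : ∀ i, ∀ n ≤ i, C i n = D n)
    (hD : ∀ j k, ∃ i ≥ k, {n | D (i + 1) n = true}.Infinite ∧
      ∃ b, Homog (C i j) b {n | D (i + 1) n = true})
    (e : ℕ → ℕ) (S : Orc) : Sat (range D) RT22 e S := by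
  simp only [RT22, sat_allS, sat_exS, sat_conj, sat_disj, sat_infinite, scons_zero]
  rintro _ ⟨j, rfl⟩
  obtain ⟨i, hi, h1, b, h2⟩ := hD j j
  rw [hC i j hi] at h2
  refine ⟨_, mem_range_self (i + 1), h1, ?_⟩
  have := (sat_homogeneous (range D) e (scons (D (i + 1)) (scons (D j) S)) 1 0 b).2 h2
  cases b
  exacts [.inl this, .inr this]

end Axioms

theorem sat_stable {f : ℕ → ℕ → Bool} {A : Bits} (h : ∀ x, ∃ n, ∀ y ≥ n, f x y = A x)
    (M : Set Bits) (e : ℕ → ℕ) (S : Orc) : Sat M (stable 0) e (scons (colorBits f) S) := by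
  simp only [stable, sat_allN, sat_imp, sat_exN, sat_disj]
  intro x _
  obtain ⟨n, hn⟩ := h x
  refine ⟨n, ?_⟩
  have key : ∀ y, IsRat y ∧ n < y ∧ x < y → colorBits f (npair x y) = A x := fun y hy => by
    rw [colorBits_npair f hy.2.2, hn y hy.2.1.le]
  cases hA : A x <;> rw [hA] at key
  · left
    intro y hy
    exact (sat_hasColor M _ _ _ _ 0 false).2 (key y (by simpa using hy))
  · right
    intro y hy
    exact (sat_hasColor M _ _ _ _ 0 true).2 (key y (by simpa using hy))

/-! ## Homogeneous sets -/

section Homogeneous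

variable {𝒮 : Set (Set Orc)} {A : Bits} {C : Orc} {f : ℕ → ℕ → Bool} {j : ℕ}

theorem limit_of_homog (hf : ∀ x, ∃ n, ∀ y ≥ n, f x y = A x) {H : Set ℕ} (hH : H.Infinite)
    {b : Bool} (h : Homog (colorBits f) b H) : ∀ x ∈ H, A x = b := by
  intro x hx
  obtain ⟨n, hn⟩ := hf x
  obtain ⟨y, hy, hny⟩ := hH.exists_gt (max x n)
  rw [max_lt_iff] at hny
  rw [← hn y hny.2.le, ← colorBits_npair f hny.1, h x hx y hy hny.1]

theorem Good.finite_of_subset_false {J : ℚ × ℚ → Set ℕ} (hG : Good 𝒮 J A C)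
    (hS : hitSet j true ∈ 𝒮) (h : ∀ n, C j n = true → A n = false) :
    {n | C j n = true}.Finite := by
  by_contra hinf
  obtain ⟨l, hl⟩ := hG 1
  obtain ⟨s, -, hs⟩ := hl ∅ (by simp)
  obtain ⟨s', -, hcov, hs'⟩ := hs _ hS (by
    rintro ⟨n, hn, hA⟩
    simp only [scons_zero, scons_succ] at hn hA
    simp [h n hn] at hA)
  choose! x hx using hs'
  obtain ⟨n, hn, hlt⟩ := Set.Infinite.exists_gt hinf (s'.sup x)
  -- An element beyond all the patches lies in some `L i` of the cover, contrary to the choice of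
  -- `i`.
  obtain ⟨i, hi, hin⟩ := hcov {n} (by simp)
  have hxi : x i ≤ s'.sup x := Finset.le_sup hi
  refine hx i hi ⟨n, hn, ?_⟩
  rw [scons_zero, patch, if_neg (by omega)]
  exact hin n (by simp)

theorem Good.exists_bound_of_subset_true {J : ℚ × ℚ → Set ℕ} (hG : Good 𝒮 J A C)
    (hS : hitSet j false ∈ 𝒮) (h : ∀ n, C j n = true → A n = true) :
    ∃ l, ∀ r : Finset (ℚ × ℚ), l ≤ r.card → (r : Set (ℚ × ℚ)).PairwiseDisjoint J →
      ∃ q ∈ r, ({n | C j n = true} ∩ J q).Finite := by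
  obtain ⟨l, hl⟩ := hG 1
  refine ⟨l, fun r hr hd => ?_⟩
  obtain ⟨s, hsr, hs⟩ := hl {r} (by simpa using ⟨hr, hd⟩)
  obtain ⟨s', hss, hcov, hs'⟩ := hs _ hS (by
    rintro ⟨n, hn, hA⟩
    simp only [scons_zero, scons_succ] at hn hA
    simp [h n hn] at hA)
  obtain ⟨i, hi, -⟩ := hcov ∅ (by simp)
  obtain ⟨x, hx⟩ := hs' i hi
  obtain ⟨q, hq, hqi⟩ := hsr i (hss hi) r (by simp)
  refine ⟨q, hq, (finite_lt_nat x).subset fun n ⟨hn, hnq⟩ => ?_⟩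
  by_contra hxn
  refine hx ⟨n, hn, ?_⟩
  rw [scons_zero, patch, if_neg (show ¬ n < x from hxn), ← Bool.not_eq_true, avoiding_eq_true]
  exact fun hno => hno q hqi hnq

end Homogeneous

/-- There is an ω-model of `RCA₀`, `WKL` and `RT22` with a stable coloring that has neither an
infinite homogeneous set with color `0` nor a homogeneous set of order type `η` with color `1`. -/
theorem exists_model : ∃ D : Orc,
    (∀ ψ ∈ RCA0 ∪ {WKL}, ∀ e S, (∀ j, S j ∈ range D) → Sat (range D) ψ e S) ∧
    (∀ e S, Sat (range D) RT22 e S) ∧ (∀ e S, Sat (range D) (stable 0) e (scons (D 0) S)) ∧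
    ∀ H ∈ range D, (∀ n, H n = true → IsRat n) →
      (Homog (D 0) false {n | H n = true} → {n | H n = true}.Finite) ∧
      (Homog (D 0) true {n | H n = true} → ∀ e S X, S X = H →
        ¬ Sat (range D) (orderTypeEta X) e S) := by
  -- The family is fixed before `A` exists; this is possible because `IsMap.const` admits all finite
  -- modifications of the `L i`.
  obtain ⟨𝒮, h𝒮, hB⟩ := exists_openFamily (countable_isMap (avoiding ratIoo))
    (fun m hm => IsMap.continuous hm) countable_isBasic fun R hR => IsBasic.isOpen hR
  obtain ⟨f, A, hf, hgen⟩ := exists_generic_coloring h𝒮.countable h𝒮.isOpen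
  obtain ⟨D, C, hD0, hC, hG, hsol⟩ := exists_columns h𝒮 (fun σ k => hB (.offCylinder σ k))
    (good_of_generic (J := ratIoo) hgen)
  replace hD0 : D 0 = colorBits f := hD0
  have hD : ∀ R, IsBasic R → ∀ k, ∃ i ≥ k,
      (∃ Y, scons Y (C i) ∉ R) → scons (D (i + 1)) (C i) ∉ R := fun R hR k =>
    hsol (.inl ⟨R, hB hR⟩) k
  refine ⟨D, ?_, fun e S => sat_RT22 hC (fun j k => hsol (.inr j) k) e S,
    fun e S => hD0 ▸ sat_stable hf _ _ _, ?_⟩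
  · rintro ψ (((h | ⟨φ, -, rfl⟩) | ⟨φ, ψ, hφ, hψ, rfl⟩) | rfl) e S hS
    · exact sat_basicAxiom h _ _ _
    · exact sat_inductionAxiom _ _ _ _
    · exact sat_comprehensionAxiom hC hD hφ hψ e hS
    · exact sat_WKL hC hD e S
  · rintro _ ⟨j, rfl⟩ hrat
    have hCj := hC j j le_rfl
    rw [hD0]
    refine ⟨fun hH => ?_, fun hH e S X hX heta => ?_⟩
    · by_contra hinf
      refine hinf ?_
      rw [← hCj]
      refine (hG j).finite_of_subset_false (hB (.hitSet j true)) fun n hn => ?_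
      exact limit_of_homog hf hinf hH n (hCj ▸ hn)
    · have key := exists_intervals_of_orderTypeEta (hX ▸ hrat) heta
      rw [hX, ← hCj] at key
      have hinf : {n | D j n = true}.Infinite := by
        obtain ⟨r, hr, -, hq⟩ := key 1
        obtain ⟨q, hqr⟩ := Finset.card_pos.1 hr
        exact hCj ▸ (hq q hqr).mono inter_subset_left
      obtain ⟨l, hl⟩ := (hG j).exists_bound_of_subset_true (hB (.hitSet j false)) fun n hn =>
        limit_of_homog hf hinf hH n (hCj ▸ hn)
      obtain ⟨r, hr, hd, hq⟩ := key l
      obtain ⟨q, hqr, hfin⟩ := hl r hr hd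
      exact hq q hqr hfin

end SOA

/-! ### The unprovability results. -/

theorem mainTheorem2 :
    ¬ SOA.Provable (SOA.RCA0 ∪ {SOA.WKL}) (SOA.RT22 ➝ SOA.SER22) ∧
      ¬ SOA.Provable (SOA.RCA0 ∪ {SOA.WKL}) (SOA.RT22 ➝ SOA.SER22Omega) := by
  obtain ⟨D, hT, hRT, hst, hno⟩ := SOA.exists_model
  have hS : ∀ j, (fun _ => D 0 : SOA.Orc) j ∈ Set.range D := fun _ => ⟨0, rfl⟩
  have hom := SOA.sat_homogeneous (Set.range D) (fun _ => 0)
  constructor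
  · intro h
    have := SOA.Derivable.sound hT h (fun _ => 0) _ hS (by simp) (hRT _ _) (D 0) ⟨0, rfl⟩ (hst _ _)
    simp only [SOA.sat_exS, SOA.sat_conj, SOA.sat_disj, SOA.sat_ratSubset, SOA.sat_infinite] at this
    obtain ⟨H, hH, hrat, ⟨h1, h2⟩ | ⟨h1, h2⟩⟩ := this
    · exact h1 ((hno H hH hrat).1 ((hom _ 1 0 false).1 h2))
    · exact (hno H hH hrat).2 ((hom _ 1 0 true).1 h2) _ _ 0 rfl h1
  · intro h
    have := SOA.Derivable.sound hT h (fun _ => 0) _ hS (by simp) (hRT _ _) (D 0) ⟨0, rfl⟩ (hst _ _)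
    simp only [SOA.sat_exS, SOA.sat_conj, SOA.sat_disj, SOA.sat_ratSubset] at this
    obtain ⟨H, hH, hrat, ⟨h1, h2⟩ | ⟨h1, h2⟩⟩ := this
    · exact SOA.infinite_of_orderTypeOmega hrat h1 ((hno H hH hrat).1 ((hom _ 1 0 false).1 h2))
    · exact (hno H hH hrat).2 ((hom _ 1 0 true).1 h2) _ _ 0 rfl h1
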